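/- **Corollary 4.3 (PCA).** There is an absolute constant $C>0$ such that the following holds. Let $1\le k<d$ and $1\le K\le N$ be integers. Let $P$ be a centred probability law on $\mathbb R^d$ with finite second moments and covariance matrix $\Sigma=\mathbb E\,YY^T$ ($Y\sim P$), such that $$\sigma^2=\sup_{\|u\|_2\le 1}\mathbb E\big(\langle u,(\Sigma-YY^T)u\rangle^2\big)<\infty .$$ Let $Y_1,\dots,Y_N$ be i.i.d. with law $P$, and let $X_1,\dots,X_N$ be an adversarially contaminated sample: there is a (possibly random) set $\mathcal O\subseteq\{1,\dots,N\}$ with $X_i=Y_i$ for all $i\notin\mathcal O$. Assume $K\ge C\,(d\vee|\mathcal O|)$. Let $B_1,\dots,B_K\subseteq\{1,\dots,N\}$ be disjoint blocks, each of size $m=\lfloor N/K\rfloor$, and $M_j=\frac1m\sum_{i\in B_j}X_iX_i^T$. For $\epsilon\ge 0$ let $S(\epsilon)$ be the set of symmetric $A\in\mathbb R^{d\times d}$ such that, for every Euclidean unit vector $u$, $|u^T(M_j-A)u|\le\epsilon$ for more than $K/2$ of the indices $j$. Let $\widehat\Sigma$ be any point of $S(\epsilon)$ with $\epsilon=4\sigma\sqrt{K/N}$.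 Let $\lambda_1\ge\dots\ge\lambda_d$ be the eigenvalues of $\Sigma$, let $\Delta_k=\lambda_k-\lambda_{k+1}$, and assume $\Delta_k>0$ and $\Delta_k\ge 16\,\sigma\sqrt{K/N}$. Let $\operatorname{Proj}_k$ and $\widehat{\operatorname{Proj}}_k$ be the orthogonal projectors of rank $k$ onto the span of eigenvectors corresponding to the $k$ largest eigenvalues (counted with multiplicity) of $\Sigma$ and of $\widehat\Sigma$, respectively. Then, with probability at least $1-\exp(-K/128)$, $S(\epsilon)$ is nonempty and every choice of $\widehat\Sigma\in S(\epsilon)$ satisfies $$\big\|\widehat{\operatorname{Proj}}_k-\operatorname{Proj}_k\big\|\le\frac{8}{\Delta_k}\,\sigma\sqrt{\frac KN}$$ in the operator norm of $\mathbb R^d$ with the Euclidean norm. -/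

import Mathlib

open MeasureTheory ProbabilityTheory

noncomputable section

namespace MomPCA

/-- The covariance matrix `Σ` of a law `P` on `ℝ^d`. -/
def covMatrix {d : ℕ} (P : Measure (EuclideanSpace ℝ (Fin d))) : Matrix (Fin d) (Fin d) ℝ :=
  Matrix.of fun i j => cov[fun y => y i, fun y => y j; P]

theorem covMatrix_isHermitian {d : ℕ} (P : Measure (EuclideanSpace ℝ (Fin d))) :
    (covMatrix P).IsHermitian := by
  ext i j
  simp [covMatrix, covariance_comm]

/-- The matrix `u ⊗ u = u uᵀ`. -/
def outer {d : ℕ} (u : EuclideanSpace ℝ (Fin d)) : Matrix (Fin d) (Fin d) ℝ :=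
  Matrix.vecMulVec u u

/-- `σ² = sup_{‖u‖₂ ≤ 1} E ⟨u, (Σ - Y Yᵀ) u⟩²` for `Y` of law `P`, as an extended
nonnegative number. -/
def sigmaSq {d : ℕ} (P : Measure (EuclideanSpace ℝ (Fin d))) : ENNReal :=
  ⨆ u ∈ Metric.closedBall (0 : EuclideanSpace ℝ (Fin d)) 1,
    ∫⁻ y, ENNReal.ofReal
      ((inner ℝ u (Matrix.toEuclideanLin (covMatrix P - outer y) u)) ^ 2) ∂P

/-- `σ`, meaningful when `sigmaSq P ≠ ⊤`. -/
def sigma {d : ℕ} (P : Measure (EuclideanSpace ℝ (Fin d))) : ℝ :=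
  Real.sqrt (sigmaSq P).toReal

/-- The block mean `(1 / |B|) ∑_{i ∈ B} x_i ⊗ x_i`. -/
def blockMean {d N : ℕ} (x : Fin N → EuclideanSpace ℝ (Fin d)) (B : Finset (Fin N)) :
    Matrix (Fin d) (Fin d) ℝ :=
  (B.card : ℝ)⁻¹ • ∑ i ∈ B, outer (x i)

/-- Trace duality `[z, x] = Tr (zᵀ x)`. -/
def traceDual {d : ℕ} (z x : Matrix (Fin d) (Fin d) ℝ) : ℝ :=
  (z.transpose * x).trace

open scoped Classical in
/-- The set `S(ε)` of the symmetric matrices `A` such that, for every Euclidean unit vector `u`,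
`|[M_k - A, u ⊗ u]| ≤ ε` for more than `K / 2` of the blocks. -/
def momSet {d N K : ℕ} (B : Fin K → Finset (Fin N)) (x : Fin N → EuclideanSpace ℝ (Fin d))
    (ε : ℝ) : Set (Matrix (Fin d) (Fin d) ℝ) :=
  {A | A.IsHermitian ∧ ∀ u : EuclideanSpace ℝ (Fin d), ‖u‖ = 1 →
    (K : ℝ) / 2 <
      ((Finset.univ.filter fun k : Fin K =>
        |traceDual (blockMean x (B k) - A) (outer u)| ≤ ε).card : ℝ)}

/-- The eigenvalues of a symmetric matrix in decreasing order, with multiplicity;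
index `0` is the largest. -/
def sortedEigenvalue {d : ℕ} {A : Matrix (Fin d) (Fin d) ℝ} (hA : A.IsHermitian) (j : Fin d) : ℝ :=
  hA.eigenvalues₀ (Fin.cast (Fintype.card_fin d).symm j)

/-- `V` is a subspace corresponding to the `k` largest eigenvalues of `A`: it is spanned by the
first `k` vectors of an orthonormal eigenbasis ordered by decreasing eigenvalue. It is unique
unless the `k`-th and `(k+1)`-st eigenvalues coincide. -/
def IsPrincipalSubspace {d : ℕ} (A : Matrix (Fin d) (Fin d) ℝ) (k : ℕ)
    (V : Submodule ℝ (EuclideanSpace ℝ (Fin d))) : Prop :=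
  ∃ (b : OrthonormalBasis (Fin d) ℝ (EuclideanSpace ℝ (Fin d))) (l : Fin d → ℝ),
    Antitone l ∧ (∀ i, Matrix.toEuclideanLin A (b i) = l i • b i) ∧
      V = Submodule.span ℝ (b '' {i | (i : ℕ) < k})

theorem exists_isPrincipalSubspace {d : ℕ} {A : Matrix (Fin d) (Fin d) ℝ} (hA : A.IsHermitian)
    (k : ℕ) : ∃ V, IsPrincipalSubspace A k V := by
  let e : Fin d ≃ Fin d :=
    (Fintype.equivOfCardEq (Fintype.card_fin _) : Fin (Fintype.card (Fin d)) ≃ Fin d).symm.trans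
      (finCongr (Fintype.card_fin d))
  refine ⟨_, hA.eigenvectorBasis.reindex e, sortedEigenvalue hA, ?_, ?_, rfl⟩
  · intro i j hij
    exact hA.eigenvalues₀_antitone (by simpa using hij)
  · intro i
    have h := hA.mulVec_eigenvectorBasis (e.symm i)
    have h2 : hA.eigenvalues (e.symm i) = sortedEigenvalue hA i := by
      simp [Matrix.IsHermitian.eigenvalues, sortedEigenvalue, e]
    ext j
    have := congrFun h j
    rw [h2] at this
    simpa [Matrix.toEuclideanLin] using this

end MomPCA

end

/-! Put `h = σ √(K/N)`. The target `8h/Δ` equals `r/Δ` with `r = 8h`, and the gap hypothesis reads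
`2r ≤ Δ`. Both halves of the argument must be sharp enough for these constants.

Deterministic half: a linear Davis-Kahan bound `2ρ/Δ` would need `|uᵀ(A - Σ)u| ≤ 4h`, which is out
of reach since membership in `S(4h)` alone already costs `4h`. Instead let `z` be a unit eigenvector
of the difference of the two projections, with eigenvalue `τ` (the sine of a principal angle). The
plane spanned by the components of `z` is invariant under both projections, and a computation there
gives `τ²(1 - τ²)Δ² ≤ ρ²` and `τ² < 1/2` (`Splits.sin_two_theta`). Since `x(1 - x)` increases on
`[0, 1/2]` and `(r/Δ)² ≤ 1/4`, it suffices that `ρ ≤ (√3/2) r = 4√3 h ≈ 6.928h`.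

Probabilistic half: it remains to reach `ρ = 6.9h = 4h + 2.9h`, that is, to show that for every `u`
more than half of the contaminated block means are within `2.9h` of `Σ` in direction `u`. Two
majorities of blocks then share a member. Uniformity in `u` comes from smoothing rather than from a
net. For a quadratic form `q`, the parallelogram law gives `q(u) = (q(u+g) + q(u-g))/2 - q(g)`, so
the indicator of a large `|q(u)|` is dominated by truncated squares at `u ± g` and `g`. Averaging
over `g` in a small ball turns the count into integrals over balls. These are controlled
simultaneously for all `u` by one exponential integral over a fixed ball, whose expectation
factorises over the independent blocks. Markov's inequality and Jensen's inequality finish; the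
price is a volume ratio `101^d`, absorbed by `K ≥ C d`. At most `0.48 K` clean blocks are bad, and
contamination spoils at most `|O| ≤ K/C` more. -/

noncomputable section

namespace MomPCA

/-! ### Perturbation of spectral projections: a `sin 2Θ` theorem. -/

section SinTwoTheta

variable {E : Type*} [NormedAddCommGroup E] [InnerProductSpace ℝ E]

/-- `V` splits the symmetric operator `S`: it is reducing, the quadratic form is at least `hi`
on `V` and at most `lo` on the orthogonal complement. -/
structure Splits (S : E →ₗ[ℝ] E) (V : Submodule ℝ E) (hi lo : ℝ) : Prop where
  orth : ∀ x ∈ V, ∀ y ∈ Vᗮ, inner ℝ (S x) y = 0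
  ge : ∀ x ∈ V, hi * ‖x‖ ^ 2 ≤ inner ℝ (S x) x
  le : ∀ y ∈ Vᗮ, inner ℝ (S y) y ≤ lo * ‖y‖ ^ 2

/-- Dimension count: if `V ∩ Wᗮ` were zero, equal ranks would force `V + Wᗮ` to be everything, yet
`z` is orthogonal to it. -/
theorem exists_mem_inf_orthogonal [FiniteDimensional ℝ E] {V W : Submodule ℝ E}
    (hVW : Module.finrank ℝ V = Module.finrank ℝ W) {z : E} (hz : z ≠ 0) (hzW : z ∈ W)
    (hzV : z ∈ Vᗮ) : ∃ a ∈ V, a ∈ Wᗮ ∧ a ≠ 0 := by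
  by_contra! h
  have h1 : V ⊓ Wᗮ = ⊥ := by
    rw [Submodule.eq_bot_iff]
    rintro x ⟨hx1, hx2⟩
    exact h x hx1 hx2
  have h2 := Submodule.finrank_sup_add_finrank_inf_eq V Wᗮ
  have h3 := Submodule.finrank_add_finrank_orthogonal W
  rw [h1, finrank_bot, add_zero, hVW, h3] at h2
  have h4 := Submodule.eq_top_of_finrank_eq h2
  have h5 : z ∈ (V ⊔ Wᗮ)ᗮ := by
    rw [← Submodule.inf_orthogonal, Submodule.orthogonal_orthogonal]
    exact ⟨hzV, hzW⟩
  rw [h4, Submodule.top_orthogonal_eq_bot] at h5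
  exact hz ((Submodule.mem_bot ℝ).1 h5)

/-- Polarisation after rescaling `x` and `y` to the common length `s t`; the parallelogram law then
makes the two quadratic bounds add up to `4ρ(st)²`. -/
theorem abs_inner_le_of_quadratic_le {D : E →ₗ[ℝ] E} (hD : D.IsSymmetric) {ρ : ℝ}
    (hρ : ∀ w, |inner ℝ (D w) w| ≤ ρ * ‖w‖ ^ 2) {x y : E} {s t : ℝ} (hs : 0 < s) (ht : 0 < t)
    (hx : ‖x‖ ^ 2 = s ^ 2) (hy : ‖y‖ ^ 2 = t ^ 2) : |inner ℝ (D x) y| ≤ ρ * (s * t) := by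
  have h1 := abs_le.1 (hρ (t • x + s • y))
  have h2 := abs_le.1 (hρ (t • x - s • y))
  have hsym : inner ℝ (D y) x = inner ℝ (D x) y := by
    rw [hD, real_inner_comm]
  have e1 : ‖t • x + s • y‖ ^ 2 = 2 * (s * t) ^ 2 + 2 * (s * t) * inner ℝ x y := by
    rw [norm_add_sq_real, norm_smul, norm_smul, mul_pow, mul_pow, hx, hy, inner_smul_left,
      inner_smul_right]
    simp; ring
  have e2 : ‖t • x - s • y‖ ^ 2 = 2 * (s * t) ^ 2 - 2 * (s * t) * inner ℝ x y := by
    rw [norm_sub_sq_real, norm_smul, norm_smul, mul_pow, mul_pow, hx, hy, inner_smul_left,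
      inner_smul_right]
    simp; ring
  have e3 : inner ℝ (D (t • x + s • y)) (t • x + s • y) - inner ℝ (D (t • x - s • y))
      (t • x - s • y) = 4 * (s * t) * inner ℝ (D x) y := by
    simp only [map_add, map_sub, map_smul, inner_add_left, inner_add_right, inner_sub_left,
      inner_sub_right, inner_smul_left, inner_smul_right, hsym]
    simp; ring
  have hst : 0 < s * t := by positivity
  rw [abs_le]
  constructor
  · refine le_of_mul_le_mul_left ?_ (by positivity : 0 < 4 * (s * t))
    rw [e1] at h1; rw [e2] at h2
    nlinarith [h1.1, h2.2]
  · refine le_of_mul_le_mul_left ?_ (by positivity : 0 < 4 * (s * t))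
    rw [e1] at h1; rw [e2] at h2
    nlinarith [h1.2, h2.1]

variable {S A : E →ₗ[ℝ] E} {V W : Submodule ℝ E} {hi lo hi' lo' ρ Δ : ℝ}

/-- Excludes a right angle between `V` and `W`: testing the forms on `a` and `z` gives `hi - ρ ≤
lo'` and `hi' ≤ lo + ρ`, hence `Δ ≤ 2ρ`. Only the order `lo' ≤ hi'` is needed for `A`, not a gap. -/
theorem Splits.eq_zero_of_mem_orthogonal (hS : Splits S V hi lo) (hA : Splits A W hi' lo')
    (hΔ : Δ ≤ hi - lo) (hgap : lo' ≤ hi') (hρ : ∀ w, |inner ℝ ((A - S) w) w| ≤ ρ * ‖w‖ ^ 2)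
    (h2 : 2 * ρ < Δ) {a z : E} (haV : a ∈ V) (haW : a ∈ Wᗮ) (hzV : z ∈ Vᗮ) (hzW : z ∈ W)
    (ha : a ≠ 0) : z = 0 := by
  by_contra hz
  have h1 := (abs_le.1 (hρ a)).1
  have h3 := (abs_le.1 (hρ z)).2
  simp only [LinearMap.sub_apply, inner_sub_left] at h1 h3
  have h4 := hS.ge a haV
  have h5 := hS.le z hzV
  have h6 := hA.ge z hzW
  have h7 := hA.le a haW
  have hap : 0 < ‖a‖ ^ 2 := by positivity
  have hzp : 0 < ‖z‖ ^ 2 := by positivity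
  have h8 : hi - ρ ≤ lo' := le_of_mul_le_mul_right (by linarith) hap
  have h9 : hi' ≤ lo + ρ := le_of_mul_le_mul_right (by linarith) hzp
  linarith

set_option maxHeartbeats 1000000 in
/-- The `sin 2Θ` theorem for one eigenvector of the difference of two spectral projections. -/
theorem Splits.sin_two_theta [FiniteDimensional ℝ E] (hS : Splits S V hi lo)
    (hA : Splits A W hi' lo')
    (hSs : S.IsSymmetric) (hAs : A.IsSymmetric)
    (hVW : Module.finrank ℝ V = Module.finrank ℝ W)
    (hΔ : Δ ≤ hi - lo) (hgap : lo' ≤ hi') (hρ : ∀ w, |inner ℝ ((A - S) w) w| ≤ ρ * ‖w‖ ^ 2)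
    (h0 : 0 ≤ ρ) (h2 : 2 * ρ < Δ) {z : E} (hz : ‖z‖ = 1) {τ : ℝ}
    (hτ : W.starProjection z - V.starProjection z = τ • z) :
    τ ^ 2 < 1 / 2 ∧ τ ^ 2 * (1 - τ ^ 2) * Δ ^ 2 ≤ ρ ^ 2 := by
  obtain ⟨a, haV, b, hbV, hab⟩ := V.exists_add_mem_mem_orthogonal z
  obtain ⟨x, hxW, y, hyW, hxy⟩ := W.exists_add_mem_mem_orthogonal z
  have hz0 : z ≠ 0 := by rintro rfl; simp at hz
  have hPa : V.starProjection z = a := by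
    rw [hab, map_add, Submodule.starProjection_eq_self_iff.2 haV,
      (Submodule.starProjection_apply_eq_zero_iff V).2 hbV, add_zero]
  have hPx : W.starProjection z = x := by
    rw [hxy, map_add, Submodule.starProjection_eq_self_iff.2 hxW,
      (Submodule.starProjection_apply_eq_zero_iff W).2 hyW, add_zero]
  rw [hPa, hPx] at hτ
  have iab : inner ℝ a b = 0 := hbV a haV
  have ixy : inner ℝ x y = 0 := hyW x hxW
  -- The eigenvalue equation says `x - a = τ z`, so the pairs `a, b` and `x, y` span the same
  -- subspace.
  have ex : x = (1 + τ) • a + τ • b := by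
    have : x = a + τ • z := by rw [← hτ]; abel
    rw [this, hab]; module
  have ey : y = (-τ) • a + (1 - τ) • b := by
    have : y = z - x := by rw [hxy]; abel
    rw [this, ex, hab]; module
  have ea : a = (1 - τ) • x + (-τ) • y := by rw [ex, ey]; module
  have eb : b = τ • x + (1 + τ) • y := by rw [ex, ey]; module
  have nab : ‖a‖ ^ 2 + ‖b‖ ^ 2 = 1 := by
    have := norm_add_sq_real a b
    rw [← hab, hz, iab] at this; linarith
  have nx : ‖x‖ ^ 2 = (1 + τ) ^ 2 * ‖a‖ ^ 2 + τ ^ 2 * ‖b‖ ^ 2 := by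
    rw [ex, norm_add_sq_real, inner_smul_left, inner_smul_right, iab, norm_smul, norm_smul,
      mul_pow, mul_pow]
    simp
  have nxz : ‖x‖ ^ 2 = (1 + τ) * ‖a‖ ^ 2 + τ * ‖b‖ ^ 2 := by
    have h1 : inner ℝ x z = ‖x‖ ^ 2 := by
      rw [hxy, inner_add_right, ixy, real_inner_self_eq_norm_sq, add_zero]
    rw [← h1, ex, hab, inner_add_left, inner_smul_left, inner_smul_left, inner_add_right,
      inner_add_right, real_inner_comm a b, iab, real_inner_self_eq_norm_sq,
      real_inner_self_eq_norm_sq]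
    simp
  have ny : ‖y‖ ^ 2 = 1 - ‖x‖ ^ 2 := by
    have := norm_add_sq_real x y
    rw [← hxy, hz, ixy] at this; linarith
  by_cases hτ0 : τ = 0
  · subst hτ0; simpa using sq_nonneg ρ
  -- Comparing Pythagoras for `x` with `⟪x, z⟫ = ‖x‖²` fixes all four lengths in terms of `τ`.
  have na : ‖a‖ ^ 2 = (1 - τ) / 2 := by
    have : τ * (‖a‖ ^ 2 - (1 - τ) / 2) = 0 := by
      have hb : ‖b‖ ^ 2 = 1 - ‖a‖ ^ 2 := by linarith
      rw [hb] at nx nxz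
      linarith
    have := (mul_eq_zero.1 this).resolve_left hτ0
    linarith
  have nb : ‖b‖ ^ 2 = (1 + τ) / 2 := by linarith
  have nx' : ‖x‖ ^ 2 = (1 + τ) / 2 := by rw [nxz, na, nb]; ring
  have ny' : ‖y‖ ^ 2 = (1 - τ) / 2 := by rw [ny, nx']; ring
  have ha0 : a ≠ 0 := by
    rintro rfl
    have h1 : τ = 1 := by
      have : (0 : ℝ) = (1 - τ) / 2 := by simpa using na
      linarith
    have hy0 : y = 0 := by
      rw [h1] at ny'; simpa using ny'
    have hzW : z ∈ W := by rw [hxy, hy0, add_zero]; exact hxW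
    have hzV : z ∈ Vᗮ := by rw [hab, zero_add]; exact hbV
    obtain ⟨c, hcV, hcW, hc⟩ := exists_mem_inf_orthogonal hVW hz0 hzW hzV
    exact hz0 (hS.eq_zero_of_mem_orthogonal hA hΔ hgap hρ h2 hcV hcW hzV hzW hc)
  have hb0 : b ≠ 0 := by
    rintro rfl
    have h1 : τ = -1 := by
      have : (0 : ℝ) = (1 + τ) / 2 := by simpa using nb
      linarith
    have hx0 : x = 0 := by
      rw [h1] at nx'; simpa using nx'
    have hzW : z ∈ Wᗮ := by rw [hxy, hx0, zero_add]; exact hyW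
    have hzV : z ∈ V := by rw [hab, add_zero]; exact haV
    obtain ⟨c, hcW, hcV, hc⟩ := exists_mem_inf_orthogonal hVW.symm hz0 hzV hzW
    exact hc (hS.eq_zero_of_mem_orthogonal hA hΔ hgap hρ h2 hzV hzW hcV hcW hz0)
  have hα : 0 < (1 - τ) / 2 := by rw [← na]; positivity
  have hβ : 0 < (1 + τ) / 2 := by rw [← nb]; positivity
  set α := (1 - τ) / 2 with hαd
  set β := (1 + τ) / 2 with hβd
  have hαβ : 4 * (α * β) = 1 - τ ^ 2 := by rw [hαd, hβd]; ring
  have hDs : (A - S).IsSymmetric := hAs.sub hSs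
  have Sba : inner ℝ (S b) a = 0 := by rw [hSs, real_inner_comm]; exact hS.orth a haV b hbV
  have Ayx : inner ℝ (A y) x = 0 := by rw [hAs, real_inner_comm]; exact hA.orth x hxW y hyW
  have Sab := hS.orth a haV b hbV
  have Axy := hA.orth x hxW y hyW
  have saa := hS.ge a haV
  have sbb := hS.le b hbV
  have axx := hA.ge x hxW
  have ayy := hA.le y hyW
  rw [na] at saa
  rw [nb] at sbb
  rw [nx'] at axx
  rw [ny'] at ayy
  have hgapS : Δ * (α * β) ≤ β * inner ℝ (S a) a - α * inner ℝ (S b) b := by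
    linarith [mul_le_mul_of_nonneg_left saa hβ.le, mul_le_mul_of_nonneg_left sbb hα.le,
      mul_le_mul_of_nonneg_right hΔ (mul_pos hα hβ).le]
  have hgapA : 0 ≤ α * inner ℝ (A x) x - β * inner ℝ (A y) y := by
    linarith [mul_le_mul_of_nonneg_left axx hα.le, mul_le_mul_of_nonneg_left ayy hβ.le,
      mul_le_mul_of_nonneg_right hgap (mul_pos hα hβ).le]
  have hΔ0 : 0 < Δ := by linarith
  have habp : 0 < α * β := mul_pos hα hβ
  constructor
  -- The `A`-form of the pair `a, b` is that of `x, y` times `cos 2θ = 1 - 2τ²`. Were this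
  -- nonpositive, moving from `S` to `A` would lose at least `Δαβ`, while the perturbation allows
  -- only `2ραβ`.
  · by_contra! hT
    have e1 := (abs_le.1 (hρ a)).1
    have e2 := (abs_le.1 (hρ b)).2
    simp only [LinearMap.sub_apply, inner_sub_left, na, nb] at e1 e2
    have Aa : inner ℝ (A a) a = (1 - τ) ^ 2 * inner ℝ (A x) x + τ ^ 2 * inner ℝ (A y) y := by
      rw [ea]
      simp only [map_add, map_smul, inner_add_left, inner_add_right, inner_smul_left,
        inner_smul_right, Axy, Ayx]
      simp; ring
    have Ab : inner ℝ (A b) b = τ ^ 2 * inner ℝ (A x) x + (1 + τ) ^ 2 * inner ℝ (A y) y := by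
      rw [eb]
      simp only [map_add, map_smul, inner_add_left, inner_add_right, inner_smul_left,
        inner_smul_right, Axy, Ayx]
      simp; ring
    have key : β * inner ℝ (A a) a - α * inner ℝ (A b) b =
        (1 - 2 * τ ^ 2) * (α * inner ℝ (A x) x - β * inner ℝ (A y) y) := by
      rw [Aa, Ab, hαd, hβd]; ring
    have h3 : β * inner ℝ (A a) a - α * inner ℝ (A b) b ≤ 0 := by
      rw [key]
      exact mul_nonpos_of_nonpos_of_nonneg (by linarith) hgapA
    have h4 : Δ * (α * β) ≤ 2 * ρ * (α * β) := by
      linarith [mul_le_mul_of_nonneg_left e1 hβ.le, mul_le_mul_of_nonneg_left e2 hα.le]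
    exact absurd (mul_lt_mul_of_pos_right h2 habp) (not_lt.2 h4)
  -- `A` has no `x, y` cross term, so the cross term of `A - S` is that of `-S`, which the gap makes
  -- at least `2|τ|Δαβ` in absolute value; it is at most `ρ√(αβ)`, and `4αβ = 1 - τ²`.
  · have e := abs_inner_le_of_quadratic_le hDs hρ (Real.sqrt_pos.2 hβ) (Real.sqrt_pos.2 hα)
      (by rw [nx', Real.sq_sqrt hβ.le]) (by rw [ny', Real.sq_sqrt hα.le])
    have Sxy : inner ℝ (S x) y = -(2 * τ) * (β * inner ℝ (S a) a - α * inner ℝ (S b) b) := by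
      rw [ex, ey]
      simp only [map_add, map_smul, inner_add_left, inner_add_right, inner_smul_left,
        inner_smul_right, Sab, Sba]
      simp [hαd, hβd]; ring
    rw [LinearMap.sub_apply, inner_sub_left, Axy, Sxy, zero_sub, abs_neg] at e
    have e2 := pow_le_pow_left₀ (abs_nonneg _) e 2
    rw [sq_abs, mul_pow, mul_pow, mul_pow, Real.sq_sqrt hα.le, Real.sq_sqrt hβ.le] at e2
    have e3 : (Δ * (α * β)) ^ 2 ≤ (β * inner ℝ (S a) a - α * inner ℝ (S b) b) ^ 2 :=
      pow_le_pow_left₀ (by positivity) hgapS 2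
    have e4 : (2 * τ) ^ 2 * (Δ * (α * β)) ^ 2 ≤ ρ ^ 2 * (β * α) :=
      le_trans (mul_le_mul_of_nonneg_left e3 (sq_nonneg _)) (by linarith)
    refine le_of_mul_le_mul_right ?_ habp
    rw [← hαβ]
    linarith

theorem norm_le_of_eigenvalue_le [FiniteDimensional ℝ E] {T : E →L[ℝ] E} (hT : T.IsSymmetric)
    {M : ℝ} (hM : 0 ≤ M)
    (h : ∀ (z : E) (τ : ℝ), ‖z‖ = 1 → T z = τ • z → |τ| ≤ M) : ‖T‖ ≤ M := by
  refine T.opNorm_le_bound hM fun x => ?_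
  let b := hT.eigenvectorBasis rfl
  have hb : ∀ i, T (b i) = hT.eigenvalues rfl i • b i := fun i =>
    hT.apply_eigenvectorBasis rfl i
  have hle : ∀ i, |hT.eigenvalues rfl i| ≤ M := fun i => h _ _ (b.orthonormal.1 i) (hb i)
  have h1 : ∀ i, inner ℝ (b i) (T x) = hT.eigenvalues rfl i * inner ℝ (b i) x := by
    intro i
    have : inner ℝ (b i) (T x) = inner ℝ (T (b i)) x := (hT (b i) x).symm
    rw [this, hb, inner_smul_left]; simp
  refine le_of_sq_le_sq ?_ (by positivity)
  rw [mul_pow, ← b.sum_sq_norm_inner_right (T x), ← b.sum_sq_norm_inner_right x, Finset.mul_sum]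
  refine Finset.sum_le_sum fun i _ => ?_
  rw [h1, norm_mul, mul_pow, Real.norm_eq_abs]
  gcongr
  exact hle i

/-- A sharp form of the Davis-Kahan theorem: if the perturbation is at most `√3/2 * r` and the
gap is at least `2 r`, the spectral projections differ by at most `r / Δ`. -/
theorem Splits.norm_starProjection_sub_le [FiniteDimensional ℝ E] (hS : Splits S V hi lo)
    (hA : Splits A W hi' lo')
    (hSs : S.IsSymmetric) (hAs : A.IsSymmetric)
    (hVW : Module.finrank ℝ V = Module.finrank ℝ W) {r : ℝ} (hr : 0 ≤ r) (hΔ0 : 0 < Δ)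
    (hΔ : Δ ≤ hi - lo) (hgap : lo' ≤ hi') (hρ : ∀ w, |inner ℝ ((A - S) w) w| ≤ ρ * ‖w‖ ^ 2)
    (h0 : 0 ≤ ρ) (hρr : 4 * ρ ^ 2 ≤ 3 * r ^ 2) (hrΔ : 2 * r ≤ Δ) :
    ‖W.starProjection - V.starProjection‖ ≤ r / Δ := by
  have h2 : 2 * ρ < Δ := by
    by_contra! hc
    nlinarith
  refine norm_le_of_eigenvalue_le ?_ (by positivity) fun z τ hz hτ => ?_
  · exact (W.starProjection_isSymmetric).sub (V.starProjection_isSymmetric)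
  · obtain ⟨h3, h4⟩ := hS.sin_two_theta hA hSs hAs hVW hΔ hgap hρ h0 h2 hz hτ
    refine abs_le_of_sq_le_sq ?_ (by positivity)
    by_contra! hc
    set g := (r / Δ) ^ 2 with hg
    have hgΔ : g * Δ ^ 2 = r ^ 2 := by rw [hg]; field_simp
    have hg4 : g ≤ 1 / 4 := by
      have : r / Δ ≤ 1 / 2 := by rw [div_le_iff₀ hΔ0]; linarith
      have h0 : 0 ≤ r / Δ := by positivity
      rw [hg]; nlinarith
    -- Monotonicity of `x(1 - x)` on `[0, 1/2]`; the contradiction comes from `1 - g ≥ 3/4`, which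
    -- is where `√3/2` originates.
    have hT : g * (1 - g) < τ ^ 2 * (1 - τ ^ 2) := by nlinarith
    have hT2 := mul_lt_mul_of_pos_right hT (by positivity : 0 < Δ ^ 2)
    have hg0 : 0 ≤ r ^ 2 := sq_nonneg r
    have : g * (1 - g) * Δ ^ 2 = r ^ 2 * (1 - g) := by rw [← hgΔ]; ring
    nlinarith

end SinTwoTheta

/-! ### Principal subspaces of symmetric matrices. -/

section PrincipalSubspace

variable {d : ℕ}

theorem isSymmetric_toEuclideanLin {A : Matrix (Fin d) (Fin d) ℝ} (hA : A.IsHermitian) :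
    (Matrix.toEuclideanLin A).IsSymmetric :=
  Matrix.isSymmetric_toEuclideanLin_iff.2 hA

theorem inner_eq_sum_of_eigenbasis {E : Type*} [NormedAddCommGroup E] [InnerProductSpace ℝ E]
    (b : OrthonormalBasis (Fin d) ℝ E) {T : E →ₗ[ℝ] E} {l : Fin d → ℝ}
    (h : ∀ i, T (b i) = l i • b i) (x y : E) :
    inner ℝ (T x) y = ∑ i, l i * (inner ℝ (b i) x * inner ℝ (b i) y) := by
  conv_lhs => rw [← b.sum_repr x, map_sum, sum_inner]
  refine Finset.sum_congr rfl fun i _ => ?_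
  rw [map_smul, h, inner_smul_left, inner_smul_left, b.repr_apply_apply]
  simp; ring

theorem IsPrincipalSubspace.finrank_eq {A : Matrix (Fin d) (Fin d) ℝ} {k : ℕ} (hk : k ≤ d)
    {V : Submodule ℝ (EuclideanSpace ℝ (Fin d))} (hV : IsPrincipalSubspace A k V) :
    Module.finrank ℝ V = k := by
  obtain ⟨b, l, -, -, rfl⟩ := hV
  have hli : LinearIndependent ℝ (fun i : {i : Fin d | (i : ℕ) < k} => b i) :=
    b.toBasis.linearIndependent.comp _ Subtype.val_injective |> fun h => by
      simpa [Function.comp_def] using h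
  have := finrank_span_eq_card hli
  rw [Set.range_comp' b, Subtype.range_coe] at this
  rw [this]
  have e : {i : Fin d | (i : ℕ) < k} ≃ Fin k :=
    ⟨fun i => ⟨i.1, i.2⟩, fun i => ⟨⟨i, i.2.trans_le hk⟩, i.2⟩, fun _ => rfl, fun _ => rfl⟩
  rw [Fintype.card_congr e, Fintype.card_fin]

theorem sortedEigenvalue_antitone {A : Matrix (Fin d) (Fin d) ℝ} (hA : A.IsHermitian) :
    Antitone (sortedEigenvalue hA) := fun i j hij =>
  hA.eigenvalues₀_antitone (by simpa using hij)

/-- Both sequences list the roots of the characteristic polynomial with multiplicity, and a multiset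
has only one decreasing enumeration. This frees `IsPrincipalSubspace` from the choice of eigenbasis.
-/
theorem eigenvalues_eq_of_antitone {A : Matrix (Fin d) (Fin d) ℝ} (hA : A.IsHermitian)
    (b : OrthonormalBasis (Fin d) ℝ (EuclideanSpace ℝ (Fin d))) {l : Fin d → ℝ} (hl : Antitone l)
    (h : ∀ i, Matrix.toEuclideanLin A (b i) = l i • b i) : l = sortedEigenvalue hA := by
  have hmat : LinearMap.toMatrix b.toBasis b.toBasis (Matrix.toEuclideanLin A) =
      Matrix.diagonal l := by
    ext i j
    rw [LinearMap.toMatrix_apply, b.coe_toBasis, h]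
    simp [Matrix.diagonal_apply]
    grind
  have hroots : A.charpoly.roots = Multiset.map l Finset.univ.val := by
    have h1 : (Matrix.toEuclideanLin A).charpoly = A.charpoly := by
      rw [Matrix.toEuclideanLin_eq_toLin_orthonormal, ← LinearMap.charpoly_toMatrix _
        (EuclideanSpace.basisFun (Fin d) ℝ).toBasis, LinearMap.toMatrix_toLin]
    rw [← h1, ← LinearMap.charpoly_toMatrix _ b.toBasis, hmat, Matrix.charpoly_diagonal,
      Polynomial.roots_prod _ _ (by simp [Finset.prod_ne_zero_iff, Polynomial.X_sub_C_ne_zero])]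
    simp
  have hsort : ∀ f : Fin d → ℝ, Antitone f →
      (Multiset.map f Finset.univ.val).sort (· ≥ ·) = List.ofFn f := by
    intro f hf
    rw [Fin.univ_val_map, Multiset.coe_sort]
    apply List.mergeSort_of_pairwise
    simp_rw [decide_eq_true_eq, ← List.sortedGE_iff_pairwise]
    exact hf.sortedGE_ofFn
  have hroots2 : A.charpoly.roots = Multiset.map (sortedEigenvalue hA) Finset.univ.val := by
    rw [hA.roots_charpoly_eq_eigenvalues₀]
    have : (Finset.univ : Finset (Fin (Fintype.card (Fin d)))) =
        Finset.univ.map (finCongr (Fintype.card_fin d).symm).toEmbedding := by simp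
    rw [this, Finset.map_val, Multiset.map_map]
    rfl
  rw [← List.ofFn_inj, ← hsort l hl, ← hsort _ (sortedEigenvalue_antitone hA), ← hroots, ← hroots2]

/-- Indices start at `0`, so `i₀` carries `λ_k` and `i₁` carries `λ_{k+1}`. -/
theorem IsPrincipalSubspace.splits {A : Matrix (Fin d) (Fin d) ℝ} (hA : A.IsHermitian) {k : ℕ}
    {i₀ i₁ : Fin d} (h₀ : (i₀ : ℕ) + 1 = k) (h₁ : (i₁ : ℕ) = k)
    {V : Submodule ℝ (EuclideanSpace ℝ (Fin d))} (hV : IsPrincipalSubspace A k V) :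
    Splits (Matrix.toEuclideanLin A) V (sortedEigenvalue hA i₀) (sortedEigenvalue hA i₁) := by
  obtain ⟨b, l, hl, hb, rfl⟩ := hV
  obtain rfl := eigenvalues_eq_of_antitone hA b hl hb
  have hmem : ∀ x ∈ Submodule.span ℝ (b '' {i | (i : ℕ) < k}), ∀ i : Fin d, k ≤ i →
      inner ℝ (b i) x = 0 := by
    intro x hx i hi
    induction hx using Submodule.span_induction with
    | mem x hx =>
      obtain ⟨j, hj, rfl⟩ := hx
      have : i ≠ j := by rintro rfl; exact absurd hj (not_lt.2 hi)
      exact b.orthonormal.2 this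
    | zero => simp
    | add x y _ _ hx hy => rw [inner_add_right, hx, hy, add_zero]
    | smul c x _ hx => rw [inner_smul_right, hx, mul_zero]
  have hperp : ∀ y ∈ (Submodule.span ℝ (b '' {i | (i : ℕ) < k}))ᗮ, ∀ i : Fin d, (i : ℕ) < k →
      inner ℝ (b i) y = 0 := fun y hy i hi =>
    hy _ (Submodule.subset_span ⟨i, hi, rfl⟩)
  refine ⟨fun x hx y hy => ?_, fun x hx => ?_, fun y hy => ?_⟩
  · rw [inner_eq_sum_of_eigenbasis b hb]
    refine Finset.sum_eq_zero fun i _ => ?_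
    rcases lt_or_ge (i : ℕ) k with hi | hi
    · rw [hperp y hy i hi]; simp
    · rw [hmem x hx i hi]; simp
  · rw [inner_eq_sum_of_eigenbasis b hb, ← b.sum_sq_norm_inner_right x, Finset.mul_sum]
    refine Finset.sum_le_sum fun i _ => ?_
    rcases lt_or_ge (i : ℕ) k with hi | hi
    · rw [Real.norm_eq_abs, sq_abs, ← sq]
      refine mul_le_mul_of_nonneg_right (hl ?_) (sq_nonneg _)
      simp only [Fin.le_def]; omega
    · rw [hmem x hx i hi]; simp
  · rw [inner_eq_sum_of_eigenbasis b hb, ← b.sum_sq_norm_inner_right y, Finset.mul_sum]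
    refine Finset.sum_le_sum fun i _ => ?_
    rcases lt_or_ge (i : ℕ) k with hi | hi
    · rw [hperp y hy i hi]; simp
    · rw [Real.norm_eq_abs, sq_abs, ← sq]
      refine mul_le_mul_of_nonneg_right (hl ?_) (sq_nonneg _)
      simp only [Fin.le_def]; omega

/-- Perturbation of principal subspaces in terms of the quadratic forms on unit vectors. -/
theorem IsPrincipalSubspace.norm_starProjection_sub_le {S A : Matrix (Fin d) (Fin d) ℝ}
    (hS : S.IsHermitian) (hA : A.IsHermitian) {k : ℕ}
    {i₀ i₁ : Fin d} (h₀ : (i₀ : ℕ) + 1 = k) (h₁ : (i₁ : ℕ) = k)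
    {V W : Submodule ℝ (EuclideanSpace ℝ (Fin d))} (hV : IsPrincipalSubspace S k V)
    (hW : IsPrincipalSubspace A k W) {Δ ρ r : ℝ}
    (hΔ : Δ = sortedEigenvalue hS i₀ - sortedEigenvalue hS i₁) (hΔ0 : 0 < Δ)
    (hρ : ∀ u : EuclideanSpace ℝ (Fin d), ‖u‖ = 1 →
      |inner ℝ u (Matrix.toEuclideanLin (A - S) u)| ≤ ρ) (h0 : 0 ≤ ρ) (hr : 0 ≤ r)
    (hρr : 4 * ρ ^ 2 ≤ 3 * r ^ 2) (hrΔ : 2 * r ≤ Δ) :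
    ‖W.starProjection - V.starProjection‖ ≤ r / Δ := by
  have hkd : k ≤ d := h₁ ▸ i₁.2.le
  refine (hV.splits hS h₀ h₁).norm_starProjection_sub_le (hW.splits hA h₀ h₁)
    (isSymmetric_toEuclideanLin hS) (isSymmetric_toEuclideanLin hA)
    (by rw [hV.finrank_eq hkd, hW.finrank_eq hkd]) hr hΔ0 hΔ.le
    (sortedEigenvalue_antitone hA (by simp only [Fin.le_def]; omega)) (fun w => ?_) h0 hρr hrΔ
  rw [← map_sub]
  by_cases hw : w = 0
  · simp [hw]
  have hw0 : 0 < ‖w‖ := norm_pos_iff.2 hw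
  have h := hρ (‖w‖⁻¹ • w) (by rw [norm_smul, norm_inv, norm_norm, inv_mul_cancel₀ hw0.ne'])
  rw [map_smul, inner_smul_left, inner_smul_right, real_inner_comm] at h
  simp only [conj_trivial, abs_mul, abs_inv, abs_norm] at h
  have := mul_le_mul_of_nonneg_right h (sq_nonneg ‖w‖)
  calc _ = ‖w‖⁻¹ * (‖w‖⁻¹ * |inner ℝ (Matrix.toEuclideanLin (A - S) w) w|) * ‖w‖ ^ 2 := by
        field_simp
    _ ≤ _ := this

end PrincipalSubspace

/-! ### Truncated squares and their exponential moments. -/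

theorem ofReal_integral_le_lintegral_ofReal {α : Type*} [MeasurableSpace α] {ν : Measure α}
    {f : α → ℝ} (hf : Integrable f ν) :
    ENNReal.ofReal (∫ x, f x ∂ν) ≤ ∫⁻ x, ENNReal.ofReal (f x) ∂ν := by
  rw [integral_eq_lintegral_pos_part_sub_lintegral_neg_part hf]
  exact (ENNReal.ofReal_le_ofReal (sub_le_self _ ENNReal.toReal_nonneg)).trans
    ENNReal.ofReal_toReal_le

/-- The square of `x / t`, truncated at level `2`. -/
def truncSq (t x : ℝ) : ℝ := min ((x / t) ^ 2) 2

theorem truncSq_nonneg (t x : ℝ) : 0 ≤ truncSq t x := le_min (sq_nonneg _) zero_le_two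

theorem truncSq_le_two (t x : ℝ) : truncSq t x ≤ 2 := min_le_right _ _

theorem measurable_truncSq (t : ℝ) : Measurable (truncSq t) := by
  unfold truncSq; fun_prop

theorem one_le_truncSq {t x : ℝ} (ht : 0 < t) (hx : t ≤ |x|) : 1 ≤ truncSq t x := by
  refine le_min ?_ one_le_two
  rw [div_pow, one_le_div (by positivity), ← sq_abs x]
  exact pow_le_pow_left₀ ht.le hx 2

/-- Without truncation this is `a² + b² ≥ (a + b)²/2`; a truncated term already contributes `2`,
which is why the level is `2`. -/
theorem two_le_truncSq_add {t a b : ℝ} (ht : 0 < t) (h : 2 * t ≤ |a + b|) :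
    2 ≤ truncSq t a + truncSq t b := by
  unfold truncSq
  have h2 : 4 ≤ ((a / t) + (b / t)) ^ 2 := by
    rw [← add_div, div_pow, le_div_iff₀ (by positivity), ← sq_abs (a + b)]
    nlinarith
  rcases le_total ((a / t) ^ 2) 2 with h3 | h3 <;> rcases le_total ((b / t) ^ 2) 2 with h4 | h4
  · rw [min_eq_left h3, min_eq_left h4]; nlinarith [sq_nonneg (a / t - b / t)]
  · rw [min_eq_right h4]; linarith [truncSq_nonneg t a, show truncSq t a = min _ 2 from rfl]
  · rw [min_eq_right h3]; linarith [truncSq_nonneg t b, show truncSq t b = min _ 2 from rfl]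
  · rw [min_eq_right h3, min_eq_right h4]; norm_num

/-- An indicator is dominated by a symmetrised truncated square. -/
theorem one_le_truncSq_symm {t s a b c e : ℝ} (ht : 0 < t) (hs : 0 < s)
    (h : a + b = 2 * c + 2 * e) (hc : t + s < |c|) :
    1 ≤ (truncSq t a + truncSq t b) / 2 + truncSq s e := by
  rcases le_or_gt s |e| with he | he
  · have := one_le_truncSq hs he
    linarith [truncSq_nonneg t a, truncSq_nonneg t b]
  · have h2 : 2 * t ≤ |a + b| := by
      rw [h, ← mul_add, abs_mul, abs_two]
      have := abs_sub_abs_le_abs_sub c (-e)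
      rw [abs_neg, sub_neg_eq_add] at this
      linarith
    linarith [two_le_truncSq_add ht h2, truncSq_nonneg s e]

/-- Convexity: on `[0, 2]` the exponential lies below its chord. -/
theorem exp_mul_truncSq_le (t x : ℝ) (l : ℝ) (hl : 0 ≤ l) :
    Real.exp (l * truncSq t x) ≤ 1 + (Real.exp (2 * l) - 1) / (2 * t ^ 2) * x ^ 2 := by
  set w := truncSq t x with hw
  have h0 := truncSq_nonneg t x
  have h2 := truncSq_le_two t x
  have hx : w ≤ (x / t) ^ 2 := min_le_left _ _
  have hc := convexOn_exp.2 (Set.mem_univ (2 * l)) (Set.mem_univ 0)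
    (by linarith : 0 ≤ w / 2) (by linarith : 0 ≤ 1 - w / 2) (by ring)
  simp only [smul_eq_mul, mul_zero, add_zero, Real.exp_zero, mul_one] at hc
  have e1 : w / 2 * (2 * l) = l * w := by ring
  rw [e1] at hc
  have h3 : 0 ≤ (Real.exp (2 * l) - 1) / 2 := by
    have := Real.one_le_exp (by linarith : 0 ≤ 2 * l); linarith
  calc Real.exp (l * w) ≤ 1 + (Real.exp (2 * l) - 1) / 2 * w := by linarith
    _ ≤ 1 + (Real.exp (2 * l) - 1) / 2 * (x / t) ^ 2 := by gcongr
    _ = _ := by rw [div_pow]; ring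

/-! ### Uniform deviation of random quadratic forms by smoothing. -/

section Deviation

variable {Ω : Type*} [MeasurableSpace Ω] {μ : Measure Ω} [IsProbabilityMeasure μ]

theorem lintegral_exp_truncSq_le {Z : Ω → ℝ} (hZ : Measurable Z) {t p l : ℝ} (ht : 0 < t)
    (hp : 0 ≤ p) (hl : 0 ≤ l)
    (h : ∫⁻ ω, ENNReal.ofReal (Z ω ^ 2) ∂μ ≤ ENNReal.ofReal (p * t ^ 2)) :
    ∫⁻ ω, ENNReal.ofReal (Real.exp (l * truncSq t (Z ω))) ∂μ ≤
      ENNReal.ofReal (Real.exp (p / 2 * (Real.exp (2 * l) - 1))) := by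
  set c := (Real.exp (2 * l) - 1) / (2 * t ^ 2) with hc
  have hc0 : 0 ≤ c := by
    have := Real.one_le_exp (by linarith : 0 ≤ 2 * l)
    exact div_nonneg (by linarith) (by positivity)
  calc _ ≤ ∫⁻ ω, (1 + ENNReal.ofReal c * ENNReal.ofReal (Z ω ^ 2)) ∂μ := by
        refine lintegral_mono fun ω => ?_
        rw [← ENNReal.ofReal_one, ← ENNReal.ofReal_mul hc0,
          ← ENNReal.ofReal_add zero_le_one (by positivity)]
        exact ENNReal.ofReal_le_ofReal (exp_mul_truncSq_le t _ l hl)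
    _ = 1 + ENNReal.ofReal c * ∫⁻ ω, ENNReal.ofReal (Z ω ^ 2) ∂μ := by
        rw [lintegral_add_left measurable_const, lintegral_const_mul _ (by fun_prop)]
        simp
    _ ≤ 1 + ENNReal.ofReal c * ENNReal.ofReal (p * t ^ 2) := by gcongr
    _ = ENNReal.ofReal (1 + c * (p * t ^ 2)) := by
        rw [ENNReal.ofReal_add zero_le_one (by positivity), ENNReal.ofReal_one,
          ENNReal.ofReal_mul hc0]
    _ ≤ _ := by
        refine ENNReal.ofReal_le_ofReal ?_
        have e : c * (p * t ^ 2) = p / 2 * (Real.exp (2 * l) - 1) := by rw [hc]; field_simp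
        rw [e, add_comm]
        exact Real.add_one_le_exp _

variable {d K : ℕ} {q : Fin K → Ω → EuclideanSpace ℝ (Fin d) → ℝ}

theorem measurable_exp_sum_truncSq (hq : ∀ j, Measurable (Function.uncurry (q j))) (l t : ℝ) :
    Measurable fun z : Ω × EuclideanSpace ℝ (Fin d) =>
      ENNReal.ofReal (Real.exp (l * ∑ j, truncSq t (q j z.1 z.2))) := by
  have : ∀ j, Measurable fun z : Ω × EuclideanSpace ℝ (Fin d) => truncSq t (q j z.1 z.2) :=
    fun j => (measurable_truncSq t).comp (hq j)
  fun_prop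

/-- The event that the exponential functional, integrated over a ball of radius `R`, does not
exceed `exp c` times the volume of a ball of radius `r`. -/
def expEvent (q : Fin K → Ω → EuclideanSpace ℝ (Fin d) → ℝ) (l t R r c : ℝ) : Set Ω :=
  {ω | ∫⁻ v in Metric.ball 0 R, ENNReal.ofReal (Real.exp (l * ∑ j, truncSq t (q j ω v))) ≤
    volume (Metric.ball (0 : EuclideanSpace ℝ (Fin d)) r) * ENNReal.ofReal (Real.exp c)}

theorem measurableSet_expEvent (hq : ∀ j, Measurable (Function.uncurry (q j))) (l t R r c : ℝ) :
    MeasurableSet (expEvent q l t R r c) :=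
  measurableSet_le (Measurable.lintegral_prod_right' (measurable_exp_sum_truncSq hq l t))
    measurable_const

/-- Tonelli, factorisation over `j` at each fixed `v`, then Markov. The factor `(R / r) ^ d` is the
ratio of the two ball volumes. -/
theorem measure_compl_expEvent_le (hq : ∀ j, Measurable (Function.uncurry (q j)))
    (hprod : ∀ v, ∀ f : ℝ → ENNReal, Measurable f →
      ∫⁻ ω, ∏ j, f (q j ω v) ∂μ = ∏ j, ∫⁻ ω, f (q j ω v) ∂μ)
    {l t R r c p : ℝ} (hl : 0 ≤ l) (ht : 0 < t) (hR : 0 < R) (hr : 0 < r) (hp : 0 ≤ p)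
    (h : ∀ v, ‖v‖ < R → ∀ j, ∫⁻ ω, ENNReal.ofReal (q j ω v ^ 2) ∂μ ≤ ENNReal.ofReal (p * t ^ 2)) :
    μ (expEvent q l t R r c)ᶜ ≤
      ENNReal.ofReal ((R / r) ^ d * Real.exp (K * (p / 2 * (Real.exp (2 * l) - 1)) - c)) := by
  have hm := measurable_exp_sum_truncSq hq l t
  set I : Ω → ENNReal := fun ω =>
    ∫⁻ v in Metric.ball 0 R, ENNReal.ofReal (Real.exp (l * ∑ j, truncSq t (q j ω v))) with hI
  set a := volume (Metric.ball (0 : EuclideanSpace ℝ (Fin d)) r) * ENNReal.ofReal (Real.exp c)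
    with ha
  have hV : volume (Metric.ball (0 : EuclideanSpace ℝ (Fin d)) r) ≠ 0 :=
    (Metric.measure_ball_pos volume 0 hr).ne'
  have hV' : volume (Metric.ball (0 : EuclideanSpace ℝ (Fin d)) r) ≠ ⊤ := measure_ball_lt_top.ne
  have ha0 : a ≠ 0 := mul_ne_zero hV (by simpa using Real.exp_pos c)
  have hat : a ≠ ⊤ := ENNReal.mul_ne_top hV' ENNReal.ofReal_ne_top
  set b := Real.exp (p / 2 * (Real.exp (2 * l) - 1)) with hb
  have hint : ∫⁻ ω, I ω ∂μ ≤
      volume (Metric.ball (0 : EuclideanSpace ℝ (Fin d)) R) * ENNReal.ofReal (b ^ K) := by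
    rw [hI, lintegral_lintegral_swap hm.aemeasurable]
    calc _ ≤ ∫⁻ v in Metric.ball (0 : EuclideanSpace ℝ (Fin d)) R, ENNReal.ofReal (b ^ K) := by
          refine setLIntegral_mono measurable_const fun v hv => ?_
          have hv' : ‖v‖ < R := by simpa using hv
          have e : ∀ ω, ENNReal.ofReal (Real.exp (l * ∑ j, truncSq t (q j ω v))) =
              ∏ j, ENNReal.ofReal (Real.exp (l * truncSq t (q j ω v))) := fun ω => by
            rw [Finset.mul_sum, Real.exp_sum, ENNReal.ofReal_prod_of_nonneg
              fun _ _ => (Real.exp_pos _).le]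
          simp_rw [e]
          have hf : Measurable fun x => ENNReal.ofReal (Real.exp (l * truncSq t x)) := by
            have := measurable_truncSq t
            fun_prop
          rw [hprod v _ hf, ENNReal.ofReal_pow (Real.exp_pos _).le]
          calc _ ≤ ∏ _j : Fin K, ENNReal.ofReal b := by
                refine Finset.prod_le_prod' fun j _ => ?_
                refine lintegral_exp_truncSq_le ?_ ht hp hl (h v hv' j)
                exact (hq j).comp measurable_prodMk_right
            _ = _ := by simp [hb]
      _ = _ := by rw [setLIntegral_const, mul_comm]
  have hR' : volume (Metric.ball (0 : EuclideanSpace ℝ (Fin d)) R) =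
      ENNReal.ofReal ((R / r) ^ d) * volume (Metric.ball (0 : EuclideanSpace ℝ (Fin d)) r) := by
    have := Measure.addHaar_ball_mul_of_pos (volume : Measure (EuclideanSpace ℝ (Fin d))) 0
      (div_pos hR hr) r
    rwa [div_mul_cancel₀ _ hr.ne', finrank_euclideanSpace_fin] at this
  calc μ (expEvent q l t R r c)ᶜ ≤ μ {ω | a ≤ I ω} := by
        refine measure_mono fun ω hω => ?_
        exact (not_le.1 (show ¬ I ω ≤ a from hω)).le
    _ ≤ (∫⁻ ω, I ω ∂μ) / a := meas_ge_le_lintegral_div hm.lintegral_prod_right'.aemeasurable ha0 hat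
    _ ≤ (volume (Metric.ball (0 : EuclideanSpace ℝ (Fin d)) R) * ENNReal.ofReal (b ^ K)) / a := by
        gcongr
    _ = _ := by
        refine (ENNReal.eq_div_iff ha0 hat).2 ?_ |>.symm
        rw [hR', ha]
        have e : b ^ K = Real.exp (K * (p / 2 * (Real.exp (2 * l) - 1)) - c) * Real.exp c := by
          rw [← Real.exp_add, sub_add_cancel, hb, ← Real.exp_nat_mul]
        rw [e, ENNReal.ofReal_mul (Real.exp_pos _).le, ENNReal.ofReal_mul (by positivity)]
        ring

theorem integrableOn_sum_truncSq (hq : ∀ j, Measurable (Function.uncurry (q j))) (t : ℝ) (ω : Ω)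
    (u : EuclideanSpace ℝ (Fin d)) (r : ℝ) :
    IntegrableOn (fun v => ∑ j, truncSq t (q j ω v)) (Metric.ball u r) := by
  refine integrable_finsetSum _ fun j _ => ?_
  refine IntegrableOn.of_bound measure_ball_lt_top ?_ 2 ?_
  · exact ((measurable_truncSq t).comp ((hq j).comp measurable_prodMk_left)).aestronglyMeasurable
  · refine Filter.Eventually.of_forall fun v => ?_
    rw [Real.norm_eq_abs, abs_of_nonneg (truncSq_nonneg _ _)]
    exact truncSq_le_two _ _

/-- Jensen's inequality on a ball inside the large one, through the tangent line of `exp` at `c`.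
The event does not involve `u`, so the bound holds for all centres at once. -/
theorem setIntegral_sum_truncSq_le (hq : ∀ j, Measurable (Function.uncurry (q j)))
    {l t R r c : ℝ} (hl : 0 < l) {ω : Ω} (hω : ω ∈ expEvent q l t R r c)
    {u : EuclideanSpace ℝ (Fin d)} (hu : ‖u‖ + r ≤ R) :
    ∫ v in Metric.ball u r, ∑ j, truncSq t (q j ω v) ≤
      volume.real (Metric.ball (0 : EuclideanSpace ℝ (Fin d)) r) * (c / l) := by
  have hF := integrableOn_sum_truncSq hq t ω u r
  set F : EuclideanSpace ℝ (Fin d) → ℝ := fun v => ∑ j, truncSq t (q j ω v) with hFd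
  have hVu : volume.real (Metric.ball u r) =
      volume.real (Metric.ball (0 : EuclideanSpace ℝ (Fin d)) r) := by
    simp only [Measure.real, Measure.addHaar_ball_center]
  set V := volume.real (Metric.ball (0 : EuclideanSpace ℝ (Fin d)) r) with hV
  have h1 : ∫⁻ v in Metric.ball u r, ENNReal.ofReal (Real.exp (l * F v)) ≤
      ENNReal.ofReal (V * Real.exp c) := by
    rw [hV, Measure.real, ENNReal.ofReal_mul ENNReal.toReal_nonneg,
      ENNReal.ofReal_toReal measure_ball_lt_top.ne]
    refine le_trans (lintegral_mono_set (Metric.ball_subset_ball' ?_)) hω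
    rw [dist_zero_right]; linarith
  have hint : IntegrableOn (fun v => Real.exp c * (1 + (l * F v - c))) (Metric.ball u r) := by
    have hc : ∀ a : ℝ, IntegrableOn (fun _ => a) (Metric.ball u r) :=
      fun a => integrableOn_const measure_ball_lt_top.ne
    exact ((hc 1).add ((hF.const_mul l).sub (hc c))).const_mul _
  have h2 : ∫ v in Metric.ball u r, Real.exp c * (1 + (l * F v - c)) ≤ V * Real.exp c := by
    have hV0 : 0 ≤ V * Real.exp c := mul_nonneg measureReal_nonneg (Real.exp_pos _).le
    rw [← ENNReal.ofReal_le_ofReal_iff hV0]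
    refine le_trans (ofReal_integral_le_lintegral_ofReal hint)
      (le_trans (lintegral_mono fun v => ?_) h1)
    refine ENNReal.ofReal_le_ofReal ?_
    have : l * F v = c + (l * F v - c) := by ring
    conv_rhs => rw [this, Real.exp_add]
    refine mul_le_mul_of_nonneg_left ?_ (Real.exp_pos _).le
    rw [add_comm]; exact Real.add_one_le_exp _
  have h3 : ∫ v in Metric.ball u r, Real.exp c * (1 + (l * F v - c)) =
      Real.exp c * (V + (l * (∫ v in Metric.ball u r, F v) - c * V)) := by
    have hc : ∀ a : ℝ, IntegrableOn (fun _ => a) (Metric.ball u r) :=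
      fun a => integrableOn_const measure_ball_lt_top.ne
    have e1 : ∫ v in Metric.ball u r, (l * F v - c) = l *
        (∫ v in Metric.ball u r, F v) - c * V := by
      rw [integral_sub (hF.const_mul l) (hc c), integral_const_mul]
      simp [hVu, mul_comm]
    have hi : IntegrableOn (fun v => l * F v - c) (Metric.ball u r) := (hF.const_mul l).sub (hc c)
    rw [integral_const_mul, integral_add (hc 1) hi, e1]
    simp [hVu]
  rw [h3, mul_comm V] at h2
  have h4 := le_of_mul_le_mul_left h2 (Real.exp_pos c)
  rw [← mul_div_assoc, le_div_iff₀ hl]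
  linarith

theorem integrableOn_comp_add_left {F : EuclideanSpace ℝ (Fin d) → ℝ}
    {u : EuclideanSpace ℝ (Fin d)} {r : ℝ} (hF : IntegrableOn F (Metric.ball u r)) :
    IntegrableOn (fun g => F (u + g)) (Metric.ball 0 r) ∧
      ∫ g in Metric.ball 0 r, F (u + g) = ∫ v in Metric.ball u r, F v := by
  have hpre : (fun g => u + g) ⁻¹' Metric.ball u r = Metric.ball 0 r := by
    ext g; simp [dist_eq_norm]
  have hmp := measurePreserving_add_left (volume : Measure (EuclideanSpace ℝ (Fin d))) u
  have he := (MeasurableEquiv.addLeft u).measurableEmbedding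
  rw [← hpre]
  exact ⟨(hmp.integrableOn_comp_preimage he).2 hF, hmp.setIntegral_preimage_emb he F _⟩

theorem integrableOn_comp_sub_left {F : EuclideanSpace ℝ (Fin d) → ℝ}
    {u : EuclideanSpace ℝ (Fin d)} {r : ℝ} (hF : IntegrableOn F (Metric.ball u r)) :
    IntegrableOn (fun g => F (u - g)) (Metric.ball 0 r) ∧
      ∫ g in Metric.ball 0 r, F (u - g) = ∫ v in Metric.ball u r, F v := by
  have hpre : (fun g => u - g) ⁻¹' Metric.ball u r = Metric.ball 0 r := by
    ext g; simp [dist_eq_norm]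
  have hmp := Measure.measurePreserving_sub_left (volume : Measure (EuclideanSpace ℝ (Fin d))) u
  have he := (MeasurableEquiv.subLeft u).measurableEmbedding
  rw [← hpre]
  exact ⟨(hmp.integrableOn_comp_preimage he).2 hF, hmp.setIntegral_preimage_emb he F _⟩

open scoped Classical in
/-- On the exponential events, few of the forms `q j ω` are large at any point of the unit ball. -/
theorem card_large_le (hq : ∀ j, Measurable (Function.uncurry (q j)))
    (hpar : ∀ j ω u g, q j ω (u + g) + q j ω (u - g) = 2 * q j ω u + 2 * q j ω g)
    {l l' t s r c c' : ℝ} (hl : 0 < l) (hl' : 0 < l') (ht : 0 < t) (hs : 0 < s) (hr : 0 < r)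
    {ω : Ω} (hω : ω ∈ expEvent q l t (1 + r) r c) (hω' : ω ∈ expEvent q l' s r r c')
    {u : EuclideanSpace ℝ (Fin d)} (hu : ‖u‖ ≤ 1) :
    ((Finset.univ.filter fun j => t + s < |q j ω u|).card : ℝ) ≤ c / l + c' / l' := by
  have h1 := setIntegral_sum_truncSq_le hq hl hω (u := u) (by linarith)
  have h2 := setIntegral_sum_truncSq_le hq hl' hω' (u := 0) (by simp)
  have i1 := integrableOn_sum_truncSq hq t ω u r
  have i2 := integrableOn_sum_truncSq hq s ω 0 r
  set F : EuclideanSpace ℝ (Fin d) → ℝ := fun v => ∑ j, truncSq t (q j ω v) with hF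
  set F' : EuclideanSpace ℝ (Fin d) → ℝ := fun v => ∑ j, truncSq s (q j ω v) with hF'
  obtain ⟨ia, ea⟩ := integrableOn_comp_add_left i1
  obtain ⟨is, es⟩ := integrableOn_comp_sub_left i1
  set n : ℝ := ((Finset.univ.filter fun j => t + s < |q j ω u|).card : ℝ) with hn
  -- The left side is free of `g`; averaging over the small ball, which is symmetric, merges `u + g`
  -- and `u - g` into one integral.
  have hpt : ∀ g, n ≤ (F (u + g) + F (u - g)) / 2 + F' g := by
    intro g
    rw [hF, hF', ← Finset.sum_add_distrib, Finset.sum_div, ← Finset.sum_add_distrib, hn,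
      Finset.card_eq_sum_ones, Nat.cast_sum, Finset.sum_filter]
    refine Finset.sum_le_sum fun j _ => ?_
    split_ifs with hj
    · exact_mod_cast one_le_truncSq_symm ht hs (hpar j ω u g) hj
    · linarith [truncSq_nonneg t (q j ω (u + g)), truncSq_nonneg t (q j ω (u - g)),
        truncSq_nonneg s (q j ω g)]
  have hV : 0 < volume.real (Metric.ball (0 : EuclideanSpace ℝ (Fin d)) r) :=
    ENNReal.toReal_pos (Metric.measure_ball_pos volume 0 hr).ne' measure_ball_lt_top.ne
  set V := volume.real (Metric.ball (0 : EuclideanSpace ℝ (Fin d)) r) with hVd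
  have i3 : IntegrableOn (fun g => (F (u + g) + F (u - g)) / 2) (Metric.ball 0 r) :=
    (ia.add is).div_const 2
  have e3 : ∫ g in Metric.ball 0 r, (F (u + g) + F (u - g)) / 2 = ∫ v in Metric.ball u r, F v := by
    rw [integral_div, integral_add ia is, ea, es]; ring
  have h3 : ∫ g in Metric.ball (0 : EuclideanSpace ℝ (Fin d)) r, n ≤
      ∫ g in Metric.ball 0 r, ((F (u + g) + F (u - g)) / 2 + F' g) :=
    integral_mono (integrableOn_const measure_ball_lt_top.ne) (i3.add i2) hpt
  rw [integral_add i3 i2, e3, setIntegral_const, smul_eq_mul, ← hVd] at h3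
  refine le_of_mul_le_mul_left ?_ hV
  linarith

/-- The first exponent has rate about `0.091 - 0.115`, the second about `-0.02`, both well below
`-1/128`. The spare room absorbs `101 ^ d ≤ exp (5 d)` and a factor `1/e` that allows the two terms
to be added. -/
theorem exp_sum_le {d K : ℕ} (hd : 0 < d) (hK : 100000 * (d : ℝ) ≤ K) {r p₁ p₂ : ℝ}
    (hr : r = 1 / 100) (hp1 : p₁ = 28 / 100) (hp2 : p₂ = 1 / 100000) :
    ((1 + r) / r) ^ d * Real.exp (K * (p₁ / 2 * (Real.exp (2 * (1 / 4)) - 1)) - 46 / 400 * K) +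
      (r / r) ^ d * Real.exp (K * (p₂ / 2 * (Real.exp (2 * 1) - 1)) - 2 / 100 * K) ≤
      Real.exp (-K / 128) := by
  subst hr hp1 hp2
  have hd1 : (1 : ℝ) ≤ d := by exact_mod_cast hd
  have e1 : Real.exp (2 * (1 / 4)) ≤ 165 / 100 := by
    have h : Real.exp (2 * (1 / 4)) ^ 2 = Real.exp 1 := by
      rw [← Real.exp_nat_mul]; norm_num
    have := Real.exp_one_lt_d9
    nlinarith [Real.exp_pos (2 * (1 / 4))]
  have e2 : Real.exp (2 * 1) ≤ 9 := by
    have h : Real.exp 1 ^ 2 = Real.exp (2 * 1) := by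
      rw [← Real.exp_nat_mul]; norm_num
    have := Real.exp_one_lt_d9
    nlinarith [Real.exp_pos 1]
  have e5 : (101 : ℝ) ≤ Real.exp 5 := by
    have h : Real.exp 1 ^ 5 = Real.exp 5 := by
      rw [← Real.exp_nat_mul]; norm_num
    have h1 := Real.exp_one_gt_d9
    rw [← h]
    calc (101 : ℝ) ≤ (2.7 : ℝ) ^ 5 := by norm_num
      _ ≤ _ := pow_le_pow_left₀ (by norm_num) (by linarith) 5
  have e101 : ((1 + 1 / 100 : ℝ) / (1 / 100)) ^ d ≤ Real.exp (5 * d) := by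
    rw [show (1 + 1 / 100 : ℝ) / (1 / 100) = 101 by norm_num, mul_comm, Real.exp_nat_mul]
    gcongr
  have e1' : ((1 / 100 : ℝ) / (1 / 100)) ^ d = 1 := by norm_num
  rw [e1', one_mul]
  have a1 : ((1 + 1 / 100 : ℝ) / (1 / 100)) ^ d *
      Real.exp (K * (28 / 100 / 2 * (Real.exp (2 * (1 / 4)) - 1)) - 46 / 400 * K) ≤
      Real.exp (-K / 128 - 1) := by
    calc _ ≤ Real.exp (5 * d) *
        Real.exp (K * (28 / 100 / 2 * (Real.exp (2 * (1 / 4)) - 1)) - 46 / 400 * K) := by gcongr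
      _ ≤ _ := by
        rw [← Real.exp_add, Real.exp_le_exp]
        nlinarith
  have a2 : Real.exp (K * (1 / 100000 / 2 * (Real.exp (2 * 1) - 1)) - 2 / 100 * K) ≤
      Real.exp (-K / 128 - 1) := by
    rw [Real.exp_le_exp]
    clear e101 e1' a1
    generalize Real.exp (2 * 1) = x at e2 ⊢
    have := mul_le_mul_of_nonneg_left e2 (Nat.cast_nonneg (α := ℝ) K)
    linarith
  have a3 : Real.exp (-K / 128 - 1) * 2 ≤ Real.exp (-K / 128) := by
    have : Real.exp (-(K : ℝ) / 128) = Real.exp (-K / 128 - 1) * Real.exp 1 := by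
      rw [← Real.exp_add, sub_add_cancel]
    rw [this]
    have := Real.exp_one_gt_d9
    gcongr
    linarith
  linarith

open scoped Classical in
/-- Uniform deviation bound: with high probability, at every unit vector at most `48 %` of
the independent random quadratic forms exceed `2.9 h`, when they have second moments
at most `2 h ^ 2` on the unit sphere. -/
theorem exists_event_card_large_le (hd : 0 < d) (hK : 100000 * (d : ℝ) ≤ K)
    (hq : ∀ j, Measurable (Function.uncurry (q j)))
    (hpar : ∀ j ω u g, q j ω (u + g) + q j ω (u - g) = 2 * q j ω u + 2 * q j ω g)
    (hprod : ∀ v, ∀ f : ℝ → ENNReal, Measurable f →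
      ∫⁻ ω, ∏ j, f (q j ω v) ∂μ = ∏ j, ∫⁻ ω, f (q j ω v) ∂μ)
    {h : ℝ} (hh : 0 < h)
    (hmom : ∀ v j, ∫⁻ ω, ENNReal.ofReal (q j ω v ^ 2) ∂μ ≤
      ENNReal.ofReal (2 * h ^ 2 * ‖v‖ ^ 4)) :
    ∃ G : Set Ω, MeasurableSet G ∧ 1 - Real.exp (-(K : ℝ) / 128) ≤ μ.real G ∧
      ∀ ω ∈ G, ∀ u : EuclideanSpace ℝ (Fin d), ‖u‖ = 1 →
        ((Finset.univ.filter fun j => 29 / 10 * h < |q j ω u|).card : ℝ) ≤ 48 / 100 * K := by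
  -- Here `t + s = 2.9 h`. Most of the threshold goes to `t`, since on a ball of radius `1/100` the
  -- forms are tiny. The values of `c / l` are `0.46 K` and `0.02 K`, totalling `0.48 K`.
  set t := 2755 / 1000 * h with ht
  set s := 145 / 1000 * h with hs
  set G₁ := expEvent q (1 / 4) t (1 + 1 / 100) (1 / 100) (46 / 400 * K) with hG1
  set G₂ := expEvent q 1 s (1 / 100) (1 / 100) (2 / 100 * K) with hG2
  have ht0 : 0 < t := by positivity
  have hs0 : 0 < s := by positivity
  have m1 : MeasurableSet G₁ := measurableSet_expEvent hq _ _ _ _ _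
  have m2 : MeasurableSet G₂ := measurableSet_expEvent hq _ _ _ _ _
  have b1 := measure_compl_expEvent_le (μ := μ) (l := 1 / 4) (t := t) (R := 1 + 1 / 100)
    (r := 1 / 100) (c := 46 / 400 * K) (p := 28 / 100) hq hprod (by norm_num) ht0 (by norm_num)
    (by norm_num) (by norm_num) (fun v hv j => (hmom v j).trans (ENNReal.ofReal_le_ofReal (by
      have : ‖v‖ ^ 4 ≤ (1 + 1 / 100) ^ 4 := pow_le_pow_left₀ (norm_nonneg v) hv.le 4
      calc 2 * h ^ 2 * ‖v‖ ^ 4 ≤ 2 * h ^ 2 * (1 + 1 / 100) ^ 4 := by gcongr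
        _ ≤ _ := by rw [ht]; nlinarith [sq_nonneg h])))
  have b2 := measure_compl_expEvent_le (μ := μ) (l := 1) (t := s) (R := 1 / 100)
    (r := 1 / 100) (c := 2 / 100 * K) (p := 1 / 100000) hq hprod (by norm_num) hs0 (by norm_num)
    (by norm_num) (by norm_num) (fun v hv j => (hmom v j).trans (ENNReal.ofReal_le_ofReal (by
      have : ‖v‖ ^ 4 ≤ (1 / 100) ^ 4 := pow_le_pow_left₀ (norm_nonneg v) hv.le 4
      calc 2 * h ^ 2 * ‖v‖ ^ 4 ≤ 2 * h ^ 2 * (1 / 100) ^ 4 := by gcongr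
        _ ≤ _ := by rw [hs]; nlinarith [sq_nonneg h])))
  refine ⟨G₁ ∩ G₂, m1.inter m2, ?_, fun ω hω u hu => ?_⟩
  · have hc : μ.real (G₁ ∩ G₂)ᶜ ≤ Real.exp (-(K : ℝ) / 128) := by
      refine ENNReal.toReal_le_of_le_ofReal (Real.exp_pos _).le ?_
      rw [Set.compl_inter]
      refine (measure_union_le _ _).trans ((add_le_add b1 b2).trans ?_)
      rw [← ENNReal.ofReal_add (by positivity) (by positivity)]
      exact ENNReal.ofReal_le_ofReal (exp_sum_le hd hK rfl rfl rfl)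
    rw [probReal_compl_eq_one_sub (m1.inter m2)] at hc
    linarith
  · have := card_large_le hq hpar (by norm_num) one_pos ht0 hs0 (by norm_num) hω.1 hω.2 hu.le
    rw [show t + s = 29 / 10 * h by rw [ht, hs]; ring] at this
    linarith

end Deviation

/-! ### Independence across disjoint blocks. -/

theorem lintegral_prod_of_disjoint_blocks {ι κ Ω 𝓔 : Type*} [MeasurableSpace Ω]
    [MeasurableSpace 𝓔] {μ : Measure Ω} [IsProbabilityMeasure μ] {Y : ι → Ω → 𝓔}
    (hY : ∀ i, Measurable (Y i)) (hi : iIndepFun Y μ) {B : κ → Finset ι}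
    (hB : Pairwise fun i j => Disjoint (B i) (B j)) {F : ∀ j, (B j → 𝓔) → ENNReal}
    (hF : ∀ j, Measurable (F j)) (T : Finset κ) :
    ∫⁻ ω, ∏ j ∈ T, F j (fun i => Y i ω) ∂μ = ∏ j ∈ T, ∫⁻ ω, F j (fun i => Y i ω) ∂μ := by
  classical
  -- Each new block is independent of the union of the earlier ones, on which their whole product
  -- depends.
  induction T using Finset.induction_on with
  | empty => simp
  | insert j T hj ih =>
    simp_rw [Finset.prod_insert hj]
    rw [← ih]
    have hdisj : Disjoint (B j) (T.biUnion B) := by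
      rw [Finset.disjoint_biUnion_right]
      intro k hk
      exact hB (by rintro rfl; exact hj hk)
    have h1 := hi.indepFun_finset (B j) (T.biUnion B) hdisj hY
    set H : (T.biUnion B → 𝓔) → ENNReal := fun z =>
      ∏ k ∈ T.attach, F k (fun i => z ⟨i, Finset.mem_biUnion.2 ⟨k, k.2, i.2⟩⟩) with hH
    have hHm : Measurable H := by
      refine Finset.measurable_fun_prod _ fun k _ => (hF k).comp ?_
      exact measurable_pi_lambda _ fun i => measurable_pi_apply _
    have h2 := h1.comp (hF j) hHm
    have e : ∀ ω, ∏ k ∈ T, F k (fun i => Y i ω) = (H ∘ fun ω (i : T.biUnion B) => Y i ω) ω := by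
      intro ω
      simp only [hH, Function.comp]
      exact (Finset.prod_attach T fun k => F k (fun i => Y i ω)).symm
    simp_rw [e]
    exact lintegral_mul_eq_lintegral_mul_lintegral_of_indepFun
      ((hF j).comp (measurable_pi_lambda _ fun i => hY i))
      (hHm.comp (measurable_pi_lambda _ fun i => hY i)) h2

/-! ### Quadratic forms and second moments of block means. -/

section Moments

variable {d : ℕ}

/-- The quadratic form of a matrix. -/
def form (A : Matrix (Fin d) (Fin d) ℝ) (u : EuclideanSpace ℝ (Fin d)) : ℝ :=
  inner ℝ u (Matrix.toEuclideanLin A u)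

theorem form_sub (A M : Matrix (Fin d) (Fin d) ℝ) (u : EuclideanSpace ℝ (Fin d)) :
    form (A - M) u = form A u - form M u := by
  simp [form, inner_sub_right]

theorem form_smul (c : ℝ) (A : Matrix (Fin d) (Fin d) ℝ) (u : EuclideanSpace ℝ (Fin d)) :
    form (c • A) u = c * form A u := by
  simp [form, inner_smul_right]

theorem form_sum {ι : Type*} (s : Finset ι) (A : ι → Matrix (Fin d) (Fin d) ℝ)
    (u : EuclideanSpace ℝ (Fin d)) : form (∑ i ∈ s, A i) u = ∑ i ∈ s, form (A i) u := by
  simp [form, inner_sum]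

theorem form_smul_vec (A : Matrix (Fin d) (Fin d) ℝ) (c : ℝ) (u : EuclideanSpace ℝ (Fin d)) :
    form A (c • u) = c ^ 2 * form A u := by
  simp [form, inner_smul_left, inner_smul_right]; ring

theorem form_parallelogram (A : Matrix (Fin d) (Fin d) ℝ) (u g : EuclideanSpace ℝ (Fin d)) :
    form A (u + g) + form A (u - g) = 2 * form A u + 2 * form A g := by
  simp only [form, map_add, map_sub, inner_add_left, inner_add_right, inner_sub_left,
    inner_sub_right]
  ring

theorem continuous_form (A : Matrix (Fin d) (Fin d) ℝ) : Continuous (form A) := by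
  have : Continuous (Matrix.toEuclideanLin A) := LinearMap.continuous_of_finiteDimensional _
  unfold form
  fun_prop

theorem form_eq_sum (A : Matrix (Fin d) (Fin d) ℝ) (u : EuclideanSpace ℝ (Fin d)) :
    form A u = ∑ i, ∑ j, u i * u j * A i j := by
  simp only [form, PiLp.inner_apply, Matrix.toEuclideanLin]
  simp only [RCLike.inner_apply, conj_trivial]
  refine Finset.sum_congr rfl fun i _ => ?_
  simp [Matrix.mulVec, dotProduct, Finset.sum_mul]
  exact Finset.sum_congr rfl fun j _ => by ring

theorem form_outer (y u : EuclideanSpace ℝ (Fin d)) : form (outer y) u = inner ℝ u y ^ 2 := by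
  rw [form_eq_sum, PiLp.inner_apply, sq, Finset.sum_mul_sum]
  refine Finset.sum_congr rfl fun i _ => Finset.sum_congr rfl fun j _ => ?_
  simp [outer, Matrix.vecMulVec_apply]; ring

theorem traceDual_outer (A : Matrix (Fin d) (Fin d) ℝ) (u : EuclideanSpace ℝ (Fin d)) :
    traceDual A (outer u) = form A u := by
  rw [form_eq_sum, traceDual, Matrix.trace, Finset.sum_comm]
  refine Finset.sum_congr rfl fun i _ => ?_
  simp only [Matrix.diag_apply, Matrix.mul_apply, Matrix.transpose_apply, outer,
    Matrix.vecMulVec_apply]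
  exact Finset.sum_congr rfl fun j _ => by ring

theorem inner_toEuclideanLin (A : Matrix (Fin d) (Fin d) ℝ) (u : EuclideanSpace ℝ (Fin d)) :
    inner ℝ u (Matrix.toEuclideanLin A u) = form A u := rfl

theorem form_zero_right (A : Matrix (Fin d) (Fin d) ℝ) : form A 0 = 0 := by simp [form]

attribute [irreducible] form

variable {P : Measure (EuclideanSpace ℝ (Fin d))}

theorem integral_inner_sq [IsProbabilityMeasure P] (h2 : MemLp id 2 P) (h0 : ∫ y, y ∂P = 0)
    (v : EuclideanSpace ℝ (Fin d)) :
    ∫ y, (inner ℝ v y) ^ 2 ∂P = form (covMatrix P) v := by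
  have hc : ∀ i, MemLp (fun y : EuclideanSpace ℝ (Fin d) => y i) 2 P := fun i =>
    (EuclideanSpace.proj (𝕜 := ℝ) i).comp_memLp' h2
  have hm : ∀ i, ∫ y : EuclideanSpace ℝ (Fin d), y i ∂P = 0 := fun i => by
    have := (EuclideanSpace.proj (𝕜 := ℝ) i).integral_comp_comm
      (h2.integrable one_le_two : Integrable (fun y => y) P)
    exact this.trans ((congrArg _ h0).trans (map_zero _))
  have hint : ∀ i j, Integrable (fun y : EuclideanSpace ℝ (Fin d) => y i * y j) P := fun i j =>
    (hc i).integrable_mul (hc j)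
  have e : ∀ y, (inner ℝ v y) ^ 2 = ∑ i, ∑ j, v i * v j * (y i * y j) := fun y => by
    rw [← form_outer, form_eq_sum]
    simp [outer, Matrix.vecMulVec_apply]
  simp_rw [e]
  rw [form_eq_sum, integral_finsetSum _ fun i _ => integrable_finsetSum _ fun j _ =>
    (hint i j).const_mul _]
  refine Finset.sum_congr rfl fun i _ => ?_
  rw [integral_finsetSum _ fun j _ => (hint i j).const_mul _]
  refine Finset.sum_congr rfl fun j _ => ?_
  rw [integral_const_mul, covMatrix, Matrix.of_apply, covariance_eq_sub (hc i) (hc j), hm, zero_mul,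
    sub_zero]
  rfl

theorem sigmaSq_eq (hs : sigmaSq P ≠ ⊤) : sigmaSq P = ENNReal.ofReal (sigma P ^ 2) := by
  rw [sigma, Real.sq_sqrt ENNReal.toReal_nonneg, ENNReal.ofReal_toReal hs]

theorem continuous_form_outer_sub :
    Continuous fun z : EuclideanSpace ℝ (Fin d) × EuclideanSpace ℝ (Fin d) =>
      form (outer z.1 - covMatrix P) z.2 := by
  simp_rw [form_sub, form_outer]
  have := continuous_form (covMatrix P)
  fun_prop

/-- Homogeneity of degree two in `v` carries the supremum over the unit ball to all vectors. -/
theorem lintegral_form_sq_le (hs : sigmaSq P ≠ ⊤) (v : EuclideanSpace ℝ (Fin d)) :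
    ∫⁻ y, ENNReal.ofReal (form (outer y - covMatrix P) v ^ 2) ∂P ≤
      ENNReal.ofReal (sigma P ^ 2 * ‖v‖ ^ 4) := by
  by_cases hv : v = 0
  · simp [hv, form_zero_right]
  have hv0 : 0 < ‖v‖ := norm_pos_iff.2 hv
  set u := ‖v‖⁻¹ • v with hu
  have hun : u ∈ Metric.closedBall (0 : EuclideanSpace ℝ (Fin d)) 1 := by
    rw [mem_closedBall_zero_iff, hu, norm_smul, norm_inv, norm_norm, inv_mul_cancel₀ hv0.ne']
  have hvu : v = ‖v‖ • u := by rw [hu, smul_inv_smul₀ hv0.ne']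
  have e : ∀ y, ENNReal.ofReal (form (outer y - covMatrix P) v ^ 2) = ENNReal.ofReal (‖v‖ ^ 4) *
      ENNReal.ofReal (inner ℝ u (Matrix.toEuclideanLin (covMatrix P - outer y) u) ^ 2) := by
    intro y
    rw [← ENNReal.ofReal_mul (by positivity)]
    congr 1
    rw [inner_toEuclideanLin]
    conv_lhs => rw [hvu, form_smul_vec]
    rw [form_sub, form_sub]; ring
  simp_rw [e]
  rw [lintegral_const_mul' _ _ ENNReal.ofReal_ne_top, mul_comm (sigma P ^ 2),
    ENNReal.ofReal_mul (by positivity), ← sigmaSq_eq hs]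
  gcongr
  exact le_iSup₂ (f := fun (u : EuclideanSpace ℝ (Fin d))
    (_ : u ∈ Metric.closedBall (0 : EuclideanSpace ℝ (Fin d)) 1) =>
    ∫⁻ y, ENNReal.ofReal
      ((inner ℝ u (Matrix.toEuclideanLin (covMatrix P - outer y) u)) ^ 2) ∂P) u hun

theorem memLp_form (hs : sigmaSq P ≠ ⊤) (v : EuclideanSpace ℝ (Fin d)) :
    MemLp (fun y => form (outer y - covMatrix P) v) 2 P := by
  have hm : Continuous fun y => form (outer y - covMatrix P) v :=
    continuous_form_outer_sub.comp (by fun_prop : Continuous fun y => (y, v))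
  rw [memLp_two_iff_integrable_sq hm.measurable.aestronglyMeasurable]
  refine ⟨(hm.pow 2).measurable.aestronglyMeasurable, ?_⟩
  rw [hasFiniteIntegral_iff_ofReal (Filter.Eventually.of_forall fun y => sq_nonneg _)]
  exact (lintegral_form_sq_le hs v).trans_lt ENNReal.ofReal_lt_top

theorem integral_form [IsProbabilityMeasure P] (h2 : MemLp id 2 P) (h0 : ∫ y, y ∂P = 0)
    (v : EuclideanSpace ℝ (Fin d)) :
    ∫ y, form (outer y - covMatrix P) v ∂P = 0 := by
  simp_rw [form_sub, form_outer]
  have hi : MemLp (fun y => inner ℝ v y) 2 P := (innerSL ℝ v).comp_memLp' h2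
  rw [integral_sub hi.integrable_sq (integrable_const _), integral_inner_sq h2 h0]
  simp

theorem integral_form_sq_le [IsProbabilityMeasure P] (hs : sigmaSq P ≠ ⊤)
    (v : EuclideanSpace ℝ (Fin d)) :
    ∫ y, form (outer y - covMatrix P) v ^ 2 ∂P ≤ sigma P ^ 2 * ‖v‖ ^ 4 := by
  rw [← ENNReal.ofReal_le_ofReal_iff (by positivity)]
  exact (ofReal_integral_le_lintegral_ofReal (memLp_form hs v).integrable_sq).trans
    (lintegral_form_sq_le hs v)

variable {N : ℕ}

theorem form_blockMean_sub (x : Fin N → EuclideanSpace ℝ (Fin d)) {B : Finset (Fin N)}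
    (hB : 0 < B.card) (M : Matrix (Fin d) (Fin d) ℝ) (v : EuclideanSpace ℝ (Fin d)) :
    form (blockMean x B - M) v = (B.card : ℝ)⁻¹ * ∑ i ∈ B, form (outer (x i) - M) v := by
  have hB' : (B.card : ℝ) ≠ 0 := by exact_mod_cast hB.ne'
  simp only [form_sub, blockMean, form_smul, form_sum, Finset.sum_sub_distrib, Finset.sum_const,
    nsmul_eq_mul, mul_sub]
  rw [inv_mul_cancel_left₀ hB']

variable {Ω : Type*} [MeasurableSpace Ω] {μ : Measure Ω} [IsProbabilityMeasure μ]
  {Y : Fin N → Ω → EuclideanSpace ℝ (Fin d)}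

theorem lintegral_form_blockMean_sq_le [IsProbabilityMeasure P] (h2 : MemLp id 2 P)
    (h0 : ∫ y, y ∂P = 0)
    (hs : sigmaSq P ≠ ⊤) (hY : ∀ i, Measurable (Y i)) (hi : iIndepFun Y μ)
    (hlaw : ∀ i, Measure.map (Y i) μ = P) {B : Finset (Fin N)} (hB : 0 < B.card)
    (v : EuclideanSpace ℝ (Fin d)) :
    ∫⁻ ω, ENNReal.ofReal (form (blockMean (fun i => Y i ω) B - covMatrix P) v ^ 2) ∂μ ≤
      ENNReal.ofReal ((B.card : ℝ)⁻¹ * (sigma P ^ 2 * ‖v‖ ^ 4)) := by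
  set f : EuclideanSpace ℝ (Fin d) → ℝ := fun y => form (outer y - covMatrix P) v with hf
  have hfc : Continuous f :=
    continuous_form_outer_sub.comp (by fun_prop : Continuous fun y => (y, v))
  have hfL : MemLp f 2 P := memLp_form hs v
  set Z : Fin N → Ω → ℝ := fun i => f ∘ Y i with hZ
  have hmp : ∀ i, MeasurePreserving (Y i) μ P := fun i => ⟨hY i, hlaw i⟩
  have hZL : ∀ i, MemLp (Z i) 2 μ := fun i => hfL.comp_measurePreserving (hmp i)
  have hmap : ∀ i, ∀ g : EuclideanSpace ℝ (Fin d) → ℝ, Measurable g →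
      ∫ ω, g (Y i ω) ∂μ = ∫ y, g y ∂P := fun i g hg => by
    have := integral_map (μ := μ) (hY i).aemeasurable (f := g) hg.aestronglyMeasurable
    rw [hlaw i] at this
    exact this.symm
  have hZm : ∀ i, ∫ ω, Z i ω ∂μ = 0 := fun i =>
    (hmap i f hfc.measurable).trans (integral_form h2 h0 v)
  have hZv : ∀ i, variance (Z i) μ ≤ sigma P ^ 2 * ‖v‖ ^ 4 := fun i => by
    rw [variance_of_integral_eq_zero (hZL i).aemeasurable (hZm i)]
    exact (hmap i (fun y => f y ^ 2) (hfc.pow 2).measurable).le.trans (integral_form_sq_le hs v)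
  have hind : iIndepFun Z μ := hi.comp _ fun _ => hfc.measurable
  have hvar := IndepFun.variance_sum (X := Z) (s := B) (fun i _ => hZL i)
    (fun i _ j _ hij => hind.indepFun hij)
  have hSL : MemLp (∑ i ∈ B, Z i) 2 μ := memLp_finsetSum' _ fun i _ => hZL i
  have hSm : ∫ ω, (∑ i ∈ B, Z i) ω ∂μ = 0 := by
    simp only [Finset.sum_apply]
    rw [integral_finsetSum _ fun i _ => (hZL i).integrable one_le_two]
    exact Finset.sum_eq_zero fun i _ => hZm i
  rw [variance_of_integral_eq_zero hSL.aemeasurable hSm] at hvar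
  have hle : ∫ ω, (∑ i ∈ B, Z i) ω ^ 2 ∂μ ≤ B.card * (sigma P ^ 2 * ‖v‖ ^ 4) := by
    refine hvar.le.trans ((Finset.sum_le_sum fun i _ => hZv i).trans ?_)
    rw [Finset.sum_const, nsmul_eq_mul]
  have hcard : (B.card : ℝ) ≠ 0 := by exact_mod_cast hB.ne'
  have e : ∀ ω, form (blockMean (fun i => Y i ω) B - covMatrix P) v ^ 2 =
      ((B.card : ℝ)⁻¹) ^ 2 * (∑ i ∈ B, Z i) ω ^ 2 := fun ω => by
    rw [form_blockMean_sub _ hB, mul_pow, Finset.sum_apply]; rfl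
  simp_rw [e]
  rw [← ofReal_integral_eq_lintegral_ofReal (hSL.integrable_sq.const_mul _)
    (Filter.Eventually.of_forall fun ω => by positivity), integral_const_mul]
  refine ENNReal.ofReal_le_ofReal ?_
  calc _ ≤ ((B.card : ℝ)⁻¹) ^ 2 * (B.card * (sigma P ^ 2 * ‖v‖ ^ 4)) := by gcongr
    _ = _ := by field_simp

theorem measurable_form_blockMean (hY : ∀ i, Measurable (Y i)) {B : Finset (Fin N)}
    (hB : 0 < B.card) :
    Measurable (Function.uncurry fun ω v =>
      form (blockMean (fun i => Y i ω) B - covMatrix P) v) := by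
  simp only [Function.uncurry_def, form_blockMean_sub _ hB]
  refine (Finset.measurable_fun_sum _ fun i _ => ?_).const_mul _
  exact (continuous_form_outer_sub (P := P)).measurable.comp
    (((hY i).comp measurable_fst).prodMk measurable_snd)

end Moments

/-! ### Clean and contaminated block means. -/

variable {d N K : ℕ} {P : Measure (EuclideanSpace ℝ (Fin d))} [IsProbabilityMeasure P]
  {Ω : Type*} [MeasurableSpace Ω] {μ : Measure Ω} [IsProbabilityMeasure μ]
  {Y : Fin N → Ω → EuclideanSpace ℝ (Fin d)} {B : Fin K → Finset (Fin N)}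

/-- Rounding down costs at most a factor `2`, as `N < K(m + 1) ≤ 2Km` for `m = N / K ≥ 1`. -/
theorem inv_natDiv_le (hK : 0 < K) (hKN : K ≤ N) :
    ((N / K : ℕ) : ℝ)⁻¹ ≤ 2 * ((K : ℝ) / N) := by
  have hm : 0 < N / K := Nat.div_pos hKN hK
  have h1 : N < K * (N / K + 1) := Nat.lt_mul_div_succ N hK
  have h2 : N ≤ 2 * K * (N / K) := by nlinarith
  have h3 : (N : ℝ) ≤ 2 * K * (N / K : ℕ) := by exact_mod_cast h2
  have hN : (0 : ℝ) < N := by exact_mod_cast hK.trans_le hKN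
  have hm' : (0 : ℝ) < (N / K : ℕ) := by exact_mod_cast hm
  rw [← mul_div_assoc, le_div_iff₀ hN, inv_mul_le_iff₀ hm']
  linarith

theorem lintegral_form_block_sq_le (h2 : MemLp id 2 P) (h0 : ∫ y, y ∂P = 0)
    (hs : sigmaSq P ≠ ⊤) (hY : ∀ i, Measurable (Y i)) (hi : iIndepFun Y μ)
    (hlaw : ∀ i, Measure.map (Y i) μ = P) (hK : 0 < K) (hKN : K ≤ N)
    (hB : ∀ j, (B j).card = N / K) (v : EuclideanSpace ℝ (Fin d)) (j : Fin K) :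
    ∫⁻ ω, ENNReal.ofReal (form (blockMean (fun i => Y i ω) (B j) - covMatrix P) v ^ 2) ∂μ ≤
      ENNReal.ofReal (2 * (sigma P * √((K : ℝ) / N)) ^ 2 * ‖v‖ ^ 4) := by
  refine (lintegral_form_blockMean_sq_le h2 h0 hs hY hi hlaw
    (by rw [hB]; exact Nat.div_pos hKN hK) v).trans (ENNReal.ofReal_le_ofReal ?_)
  rw [hB, mul_pow, Real.sq_sqrt (by positivity)]
  calc _ ≤ 2 * ((K : ℝ) / N) * (sigma P ^ 2 * ‖v‖ ^ 4) := by
        gcongr; exact inv_natDiv_le hK hKN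
    _ = _ := by ring

/-- Almost sure vanishing on a countable dense set extends to all `v` by continuity. This covers `σ
= 0`, where the thresholds `t` and `s` degenerate. -/
theorem exists_event_forall_eq_zero {q : Fin K → Ω → EuclideanSpace ℝ (Fin d) → ℝ}
    (hq : ∀ j, Measurable (Function.uncurry (q j))) (hc : ∀ j ω, Continuous (q j ω))
    (hmom : ∀ v j, ∫⁻ ω, ENNReal.ofReal (q j ω v ^ 2) ∂μ ≤ 0) :
    ∃ G : Set Ω, MeasurableSet G ∧ μ.real G = 1 ∧ ∀ ω ∈ G, ∀ j v, q j ω v = 0 := by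
  have hz : ∀ᵐ ω ∂μ, ∀ n j, q j ω (TopologicalSpace.denseSeq _ n) = 0 := by
    refine ae_all_iff.2 fun n => ae_all_iff.2 fun j => ?_
    have hm : Measurable fun ω => q j ω (TopologicalSpace.denseSeq _ n) :=
      (hq j).comp measurable_prodMk_right
    have h := (lintegral_eq_zero_iff (hm.pow_const 2).ennreal_ofReal).1
      (nonpos_iff_eq_zero.1 (hmom (TopologicalSpace.denseSeq _ n) j))
    filter_upwards [h] with ω hω
    have h3 := ENNReal.ofReal_eq_zero.1 hω
    exact (pow_eq_zero_iff two_ne_zero).1 (le_antisymm h3 (sq_nonneg _))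
  refine ⟨(toMeasurable μ {ω | ¬ ∀ n j, q j ω (TopologicalSpace.denseSeq _ n) = 0})ᶜ,
    (measurableSet_toMeasurable _ _).compl, ?_, fun ω hω j v => ?_⟩
  · rw [probReal_compl_eq_one_sub (measurableSet_toMeasurable _ _), Measure.real,
      measure_toMeasurable, ae_iff.1 hz]
    simp
  · have h4 := not_not.1 fun h => hω (subset_toMeasurable _ _ h)
    have h5 := (TopologicalSpace.denseRange_denseSeq _).equalizer (hc j ω) continuous_const
      (funext fun n => h4 n j)
    exact congrFun h5 v

open scoped Classical in
/-- The clean block means are uniformly close to the covariance matrix in most blocks. -/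
theorem exists_event_blockMean (hd : 0 < d) (hKd : 100000 * (d : ℝ) ≤ K)
    (h2 : MemLp id 2 P) (h0 : ∫ y, y ∂P = 0)
    (hs : sigmaSq P ≠ ⊤) (hY : ∀ i, Measurable (Y i)) (hi : iIndepFun Y μ)
    (hlaw : ∀ i, Measure.map (Y i) μ = P) (hK : 0 < K) (hKN : K ≤ N)
    (hB : ∀ j, (B j).card = N / K) (hdisj : Pairwise fun i j => Disjoint (B i) (B j)) :
    ∃ G : Set Ω, MeasurableSet G ∧ 1 - Real.exp (-(K : ℝ) / 128) ≤ μ.real G ∧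
      ∀ ω ∈ G, ∀ u : EuclideanSpace ℝ (Fin d), ‖u‖ = 1 →
        ((Finset.univ.filter fun j => 29 / 10 * (sigma P * √((K : ℝ) / N)) <
          |form (blockMean (fun i => Y i ω) (B j) - covMatrix P) u|).card : ℝ) ≤ 48 / 100 * K := by
  have hcard : ∀ j, 0 < (B j).card := fun j => by rw [hB]; exact Nat.div_pos hKN hK
  have hmom := lintegral_form_block_sq_le (B := B) h2 h0 hs hY hi hlaw hK hKN hB
  have hN : (0 : ℝ) < N := by exact_mod_cast hK.trans_le hKN
  have hK' : (0 : ℝ) < K := by exact_mod_cast hK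
  have hq := fun j => measurable_form_blockMean (P := P) hY (hcard j)
  set q : Fin K → Ω → EuclideanSpace ℝ (Fin d) → ℝ := fun j ω v =>
    form (blockMean (fun i => Y i ω) (B j) - covMatrix P) v with hqd
  have hσ : 0 ≤ sigma P := Real.sqrt_nonneg _
  rcases hσ.eq_or_lt with hσ | hσ
  · obtain ⟨G, hG, hG1, hG0⟩ := exists_event_forall_eq_zero (μ := μ) hq
      (fun j ω => continuous_form _) (fun v j => (hmom v j).trans_eq (by simp [← hσ]))
    refine ⟨G, hG, by rw [hG1]; linarith [Real.exp_pos (-(K : ℝ) / 128)], fun ω hω u _ => ?_⟩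
    have h3 : ∀ j, form (blockMean (fun i => Y i ω) (B j) - covMatrix P) u = 0 := fun j =>
      hG0 ω hω j u
    simp only [h3, abs_zero, ← hσ, zero_mul, mul_zero, lt_irrefl, Finset.filter_false,
      Finset.card_empty, Nat.cast_zero]
    positivity
  · refine exists_event_card_large_le (μ := μ) hd hKd hq
      (fun j ω u g => form_parallelogram _ u g) (fun v f hf => ?_)
      (by positivity) hmom
    have hcont : Measurable fun y : EuclideanSpace ℝ (Fin d) => form (outer y - covMatrix P) v :=
      (continuous_form_outer_sub.comp (by fun_prop : Continuous fun y => (y, v))).measurable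
    have := lintegral_prod_of_disjoint_blocks (μ := μ) hY hi hdisj
      (F := fun j z => f (((B j).card : ℝ)⁻¹ * ∑ i, form (outer (z i) - covMatrix P) v))
      (fun j => hf.comp ((Finset.measurable_fun_sum _ fun i _ =>
        hcont.comp (measurable_pi_apply i)).const_mul _)) Finset.univ
    have e : ∀ j ω, ∑ i ∈ B j, form (outer (Y i ω) - covMatrix P) v =
        ∑ i : B j, form (outer (Y i ω) - covMatrix P) v := fun j ω =>
      (Finset.sum_coe_sort (B j) fun i => form (outer (Y i ω) - covMatrix P) v).symm
    simp only [form_blockMean_sub _ (hcard _), e]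
    exact this

open scoped Classical in
theorem card_blocks_meeting_le (hdisj : Pairwise fun i j => Disjoint (B i) (B j))
    (O : Finset (Fin N)) :
    (Finset.univ.filter fun j => (B j ∩ O).Nonempty).card ≤ O.card := by
  calc _ ≤ ∑ j ∈ Finset.univ.filter (fun j => (B j ∩ O).Nonempty), (B j ∩ O).card := by
        rw [Finset.card_eq_sum_ones]
        refine Finset.sum_le_sum fun j hj => ?_
        exact Finset.card_pos.2 (Finset.mem_filter.1 hj).2
    _ = ((Finset.univ.filter fun j => (B j ∩ O).Nonempty).biUnion fun j => B j ∩ O).card := by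
        refine (Finset.card_biUnion fun i _ j _ hij => ?_).symm
        exact (hdisj hij).mono Finset.inter_subset_left Finset.inter_subset_left
    _ ≤ _ := Finset.card_le_card (Finset.biUnion_subset.2 fun _ _ => Finset.inter_subset_right)

open scoped Classical in
/-- If the clean block means are close to `M` in most blocks, and few indices are contaminated,
then more than half of the contaminated block means are close to `M`. -/
theorem half_lt_card_close (hK : 0 < K) (hdisj : Pairwise fun i j => Disjoint (B i) (B j))
    {x y : Fin N → EuclideanSpace ℝ (Fin d)} {O : Finset (Fin N)} (hxy : ∀ i, i ∉ O → x i = y i)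
    (hO : 100000 * (O.card : ℝ) ≤ K) {M : Matrix (Fin d) (Fin d) ℝ} {e : ℝ}
    {u : EuclideanSpace ℝ (Fin d)}
    (h : ((Finset.univ.filter fun j => e < |form (blockMean y (B j) - M) u|).card : ℝ) ≤
      48 / 100 * K) :
    (K : ℝ) / 2 <
      ((Finset.univ.filter fun j => |form (blockMean x (B j) - M) u| ≤ e).card : ℝ) := by
  have hcover : (Finset.univ : Finset (Fin K)) ⊆
      ((Finset.univ.filter fun j => |form (blockMean x (B j) - M) u| ≤ e) ∪
        (Finset.univ.filter fun j => e < |form (blockMean y (B j) - M) u|)) ∪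
        (Finset.univ.filter fun j => (B j ∩ O).Nonempty) := by
    intro j _
    simp only [Finset.mem_union, Finset.mem_filter, Finset.mem_univ, true_and]
    by_cases hj : (B j ∩ O).Nonempty
    · exact Or.inr hj
    · have hb : blockMean x (B j) = blockMean y (B j) := by
        unfold blockMean
        congr 1
        refine Finset.sum_congr rfl fun i hi => ?_
        rw [hxy i fun hiO => hj ⟨i, Finset.mem_inter.2 ⟨hi, hiO⟩⟩]
      rw [hb]
      exact Or.inl (le_or_gt _ _)
  have h1 := (Finset.card_le_card hcover).trans
    ((Finset.card_union_le _ _).trans (Nat.add_le_add_right (Finset.card_union_le _ _) _))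
  rw [Finset.card_univ, Fintype.card_fin] at h1
  have h2 := (Nat.cast_le (α := ℝ)).2 h1
  push_cast at h2
  have h3 : ((Finset.univ.filter fun j => (B j ∩ O).Nonempty).card : ℝ) ≤ O.card := by
    exact_mod_cast card_blocks_meeting_le hdisj O
  have hK' : (0 : ℝ) < K := by exact_mod_cast hK
  linarith

open scoped Classical in
theorem exists_mem_inter_of_half_lt {p r : Fin K → Prop}
    (hp : (K : ℝ) / 2 < ((Finset.univ.filter p).card : ℝ))
    (hr : (K : ℝ) / 2 < ((Finset.univ.filter r).card : ℝ)) : ∃ j, p j ∧ r j := by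
  by_contra! h
  have hd : Disjoint (Finset.univ.filter p) (Finset.univ.filter r) :=
    Finset.disjoint_filter.2 fun j _ => h j
  have h1 := Finset.card_le_univ (Finset.univ.filter p ∪ Finset.univ.filter r)
  rw [Finset.card_union_of_disjoint hd, Fintype.card_fin] at h1
  have h2 : (((Finset.univ.filter p).card : ℝ) + (Finset.univ.filter r).card) ≤ K := by
    exact_mod_cast h1
  linarith

end MomPCA

end

theorem corollary4p3 :
    ∃ C : ℝ, 0 < C ∧
      ∀ (d N K k : ℕ) (hk : 0 < k) (hkd : k < d), 0 < K → K ≤ N →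
      -- the law of the clean sample: centred, with finite second moments and finite `σ`
      ∀ (P : Measure (EuclideanSpace ℝ (Fin d))) [IsProbabilityMeasure P],
        MemLp id 2 P → ∫ y, y ∂P = 0 → MomPCA.sigmaSq P ≠ ⊤ →
      -- the clean i.i.d. sample `Y`, the adversarially contaminated sample `X`
      ∀ (Ω : Type*) [MeasurableSpace Ω] (μ : Measure Ω) [IsProbabilityMeasure μ]
        (Y X : Fin N → Ω → EuclideanSpace ℝ (Fin d)) (O : Ω → Finset (Fin N)),
        (∀ i, Measurable (Y i)) → iIndepFun Y μ → (∀ i, Measure.map (Y i) μ = P) →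
        (∀ ω, ∀ i, i ∉ O ω → X i ω = Y i ω) →
        (∀ ω, C * max (d : ℝ) ((O ω).card : ℝ) ≤ (K : ℝ)) →
      -- the blocks
      ∀ (B : Fin K → Finset (Fin N)), (∀ i, (B i).card = N / K) →
        Pairwise (fun i j => Disjoint (B i) (B j)) →
      -- the spectral gap
      ∀ (Δ : ℝ),
        Δ = MomPCA.sortedEigenvalue (MomPCA.covMatrix_isHermitian P) ⟨k - 1, by omega⟩
          - MomPCA.sortedEigenvalue (MomPCA.covMatrix_isHermitian P) ⟨k, hkd⟩ →
        0 < Δ → 16 * MomPCA.sigma P * √((K : ℝ) / N) ≤ Δ →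
      ∃ E : Set Ω, MeasurableSet E ∧ 1 - Real.exp (-(K : ℝ) / 128) ≤ μ.real E ∧
        ∀ ω ∈ E,
          (MomPCA.momSet B (fun i => X i ω) (4 * MomPCA.sigma P * √((K : ℝ) / N))).Nonempty ∧
          ∀ A ∈ MomPCA.momSet B (fun i => X i ω) (4 * MomPCA.sigma P * √((K : ℝ) / N)),
          ∀ V W : Submodule ℝ (EuclideanSpace ℝ (Fin d)),
            MomPCA.IsPrincipalSubspace (MomPCA.covMatrix P) k V →
            MomPCA.IsPrincipalSubspace A k W →
            ‖W.starProjection - V.starProjection‖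
              ≤ 8 / Δ * MomPCA.sigma P * √((K : ℝ) / N) := by
  -- This constant pays both for `101 ^ d` and for the contaminated blocks, which must fit in the
  -- margin `K/2 - 0.48 K`.
  refine ⟨100000, by norm_num, ?_⟩
  intro d N K k hk hkd hK hKN P _ h2 h0 hs Ω _ μ _ Y X O hY hi hlaw hXY hO B hB hdisj Δ hΔ hΔ0 hgap
  have hO' : ∀ ω, 100000 * (d : ℝ) ≤ K ∧ 100000 * ((O ω).card : ℝ) ≤ K := fun ω => by
    have h1 := le_max_left (d : ℝ) ((O ω).card : ℝ)
    have h2 := le_max_right (d : ℝ) ((O ω).card : ℝ)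
    have := hO ω
    constructor <;> linarith
  -- The bound `K ≥ C d` is assumed pointwise in `ω`, so one sample point is needed to extract it.
  obtain ⟨ω₀⟩ := nonempty_of_isProbabilityMeasure μ
  obtain ⟨E, hE, hEp, hEc⟩ := MomPCA.exists_event_blockMean (hk.trans hkd) (hO' ω₀).1 h2 h0 hs hY hi
    hlaw hK hKN hB hdisj
  refine ⟨E, hE, hEp, fun ω hω => ?_⟩
  set h := MomPCA.sigma P * √((K : ℝ) / N) with hh
  have hh0 : 0 ≤ h := mul_nonneg (Real.sqrt_nonneg _) (Real.sqrt_nonneg _)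
  have e4 : 4 * MomPCA.sigma P * √((K : ℝ) / N) = 4 * h := by rw [hh]; ring
  have hclose := fun u hu =>
    MomPCA.half_lt_card_close hK hdisj (hXY ω) (hO' ω).2 (hEc ω hω u hu)
  rw [e4]
  refine ⟨⟨MomPCA.covMatrix P, MomPCA.covMatrix_isHermitian P, fun u hu => ?_⟩, ?_⟩
  · refine (hclose u hu).trans_le ?_
    simp only [MomPCA.traceDual_outer]
    refine Nat.cast_le.2 (Finset.card_le_card (Finset.monotone_filter_right _ ?_))
    intro j _ hj
    exact hj.trans (by linarith)
  · rintro A ⟨hA, hAc⟩ V W hV hW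
    have e8 : 8 / Δ * MomPCA.sigma P * √((K : ℝ) / N) = 8 * h / Δ := by rw [hh]; ring
    rw [e8]
    -- With `ρ = 6.9h` and `r = 8h`, the requirement `4ρ² ≤ 3r²` reads `190.44 ≤ 192`.
    refine MomPCA.IsPrincipalSubspace.norm_starProjection_sub_le (MomPCA.covMatrix_isHermitian P) hA
      (i₀ := ⟨k - 1, (Nat.sub_le k 1).trans_lt hkd⟩) (i₁ := ⟨k, hkd⟩) (Nat.sub_add_cancel hk) rfl
      hV hW hΔ hΔ0 (ρ := 69 / 10 * h) (fun u hu => ?_) (by positivity) (by positivity)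
      (by nlinarith [sq_nonneg h]) (by rw [hh]; linarith)
    have h3 := hAc u hu
    simp only [MomPCA.traceDual_outer] at h3
    obtain ⟨j, hj1, hj2⟩ := MomPCA.exists_mem_inter_of_half_lt (hclose u hu) h3
    rw [MomPCA.inner_toEuclideanLin, MomPCA.form_sub]
    rw [MomPCA.form_sub, abs_le] at hj1 hj2
    rw [abs_le]
    constructor <;> linarith [hj1.1, hj1.2, hj2.1, hj2.2]
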